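/- **Setting.** Let $X$ be a real vector space with a $\sigma$-algebra $\mathcal F$ stable under translations and under dilations of nonzero ratio, and let $d\ge 1$. A *box* is a translate of $\Lambda(n)=[0,n[^d\cap\mathbb Z^d$, $n\ge 1$; $\mathbb B$ is the set of boxes. Put $\mathfrak m_\Lambda(\sigma)=|\Lambda|^{-1}\sum_{z\in\Lambda}\sigma(z)$ for $\sigma\in X^{\mathbb Z^d}$, and for finite $S\subset\mathbb Z^d$ let $\mathcal F_S$ be the $\sigma$-algebra generated by the $\mathfrak m_\Lambda$ for the boxes $\Lambda\subset S$. A *compatible translation-invariant system* on $X^{\mathbb Z^d}$ is a family of probability measures $\mu_\Lambda$ on $\mathcal F_\Lambda$ ($\Lambda\in\mathbb B$) with $\mu_{\Lambda_2}=\mu_{\Lambda_1}$ on $\mathcal F_{\Lambda_1}$ if $\Lambda_1\subset\Lambda_2$, and $\mu_{\Lambda+z}(A+z)=\mu_\Lambda(A)$ for $z\in\mathbb Z^d$, $A\in\mathcal F_\Lambda$, where $A+z=\{\sigma(\cdot-z):\sigma\in A\}$. Write $\mathbb P(A)=\mu_\Lambda(A)$ for $A\in\mathcal F_\Lambda$.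 It is *carried by* $E\subset X^{\mathbb Z^d}$ if $\mu_\Lambda(A)=\mu_\Lambda(B)$ whenever $A,B\in\mathcal F_\Lambda$ and $A\cap E=B\cap E$. Its *Cramér sequence* is $\mu_n=\mu_{\Lambda(n)}\circ\mathfrak m_{\Lambda(n)}^{-1}$. A convex set $C\subset X$ with gauge $M_C(x)=\inf\{t\ge0: x\in tC\}$ is *internal* if $M_C<\infty$ everywhere and $C=\{M_C<1\}$; $\mathcal C_0(\mathcal F)$ is the set of measurable internal convex sets. A system $(\mu_\Lambda)$ is * *lower asymptotically decoupled* if there are $g,c:\mathbb N^*\to[0,\infty[$ with $g(m)/m\to0$ and $c(m)/|\Lambda(m)|\to0$ such that for all $m\ge1$, all finite $S\subset\mathbb Z^d$ with $\mathrm{dist}_\infty(S,\Lambda(m))>g(m)$, all $A\in\mathcal F_{\Lambda(m)}$ and $B\in\mathcal F_S$: $\mathbb P(A\cap B)\ge e^{-c(m)}\mathbb P(A)\mathbb P(B)$; * *locally controlled* if there are $t,\alpha:\mathcal C_0(\mathcal F)\to\,]0,\infty[$ with $\mathbb P(\sigma(0)\in t(C)C\mid\mathcal F_{\Lambda\setminus\{0\}})\ge\alpha(C)$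 a.s. for all $C\in\mathcal C_0(\mathcal F)$ and all boxes $\Lambda\ni0$; * *locally convex-tight on $D\subset X$* (for a topology on $X$) if for every $\gamma>0$ there is $K\in\mathcal F$ with $K\cap D$ convex and relatively compact such that $\mathbb P(\sigma(0)\in K\mid\mathcal F_{\Lambda\setminus\{0\}})\ge1-\gamma$ a.s. for all boxes $\Lambda\ni0$. A *measurable locally convex space* is $(X,\mathcal C_0,\mathcal F,\tau)$ with $X,\mathcal F$ as above, $\mathcal C_0\subset\mathcal C_0(\mathcal F)$ a nonempty family of symmetric sets, stable under finite intersections and nonzero dilations, with $\bigcap\mathcal C_0=\{0\}$, and $\tau$ the locally convex topology with $\mathcal C_0$ as a base of neighbourhoods of $0$, such that every $\tau$-continuous linear form is measurable. A *projective system* $(X_i,f_i,f_{ij})_{i\le j}$ over a nonempty directed preordered set $J$ consists of measurable locally convex spaces $(X_i,\mathcal C_{0,i},\mathcal F_i,\tau_i)$, measurable linear maps $f_i:X\to X_i$ and continuous measurable linear maps $f_{ij}:X_j\to X_i$ ($i\le j$) with $f_{ii}=\mathrm{id}$, $f_i=f_{ij}\circ f_j$ and $f_{ik}=f_{ij}\circ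 f_{jk}$. Its *projective limit* is $(X,\mathcal C_0,\mathcal F,\tau)$ with $\mathcal C_0=\{f_i^{-1}(C): i\in J,\ C\in\mathcal C_{0,i}\}$ and $\tau$ the topology generated by the translates of the elements of $\mathcal C_0$. Let $X^*$ be the topological dual of $(X,\tau)$. Write $f_i^{\mathbb Z^d}$ for the map induced by $f_i$ on configurations. For a sequence $(\mu_n)_{n\ge 1}$ of probability measures on $X$, the *entropy* and the *pressure* are $$s(x)=\inf_{C\in\mathcal C_0}\liminf_{n\to\infty}\frac{\log\mu_n(x+C)}{|\Lambda(n)|},\qquad p(\lambda)=\limsup_{n\to\infty}\frac1{|\Lambda(n)|}\log\int e^{|\Lambda(n)|\langle\lambda|x\rangle}\,d\mu_n(x).$$ **Theorem (projective limits).** Let $(X_i,f_i,f_{ij})$ be a projective system of measurable locally convex spaces with projective limit $(X,\mathcal C_0,\mathcal F,\tau)$, $d\ge1$, $D\subset X$ convex, $(\mu_\Lambda)$ a compatible translation-invariant system on $X^{\mathbb Z^d}$ carried by $D^{\mathbb Z^d}$, and $(\mu_n)$ its Cramér sequence. Assume that, for every $i\in J$, $(\mu_\Lambda\circ(f_i^{\mathbb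 Z^d})^{-1})_\Lambda$ is lower asymptotically decoupled and locally controlled. Then: 1. for every $K\in\mathcal F$ such that $K\cap D$ is relatively compact, $\limsup_n|\Lambda(n)|^{-1}\log\mu_n(K)\le\sup_{\overline K}s$. In particular $(\mu_n)$ satisfies the weak large deviation principle at speed $|\Lambda(n)|$ with entropy $s$, i.e. $\liminf_n|\Lambda(n)|^{-1}\log\mu_n(A)\ge\sup_{\mathring A}s$ for all $A\in\mathcal F$, and $\limsup_n|\Lambda(n)|^{-1}\log\mu_n(K)\le\sup_{\overline K}s$ for all relatively compact $K\in\mathcal F$. The traces $\mu_n|_D$ of the $\mu_n$ on $D$ also satisfy the weak large deviation principle on $D$, for the trace topology and $\sigma$-algebra, the entropy being defined with the traces on $D$ of the sets $x+C$, $C\in\mathcal C_0$; 2. for every $\lambda\in X^*$ the $\limsup$ defining $p(\lambda)$ is a limit in $[-\infty,+\infty]$, and $p(\lambda)-s(x)\ge\langle\lambda|x\rangle$ for every $x\in X$; 3. if moreover, for every $i\in J$, $(\mu_\Lambda\circ(f_i^{\mathbb Z^d})^{-1})_\Lambda$ is locally convex-tight on $f_i(D)$ for $\tau_i$, then $s=-p^*$,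 i.e. $s(x)=\inf_{\lambda\in X^*}\big(p(\lambda)-\langle\lambda|x\rangle\big)$ for every $x\in X$. -/

import Mathlib

open MeasureTheory ProbabilityTheory Filter Topology
open scoped ENNReal NNReal Pointwise

noncomputable section

namespace CramerField

/-! ### Boxes, configurations and block averages -/

/-- A box of `ℤ^d`: the cube `corner + [0, side[^d ∩ ℤ^d`, with `side ≥ 1`. -/
structure Box (d : ℕ) where
  corner : Fin d → ℤ
  side : ℕ+

/-- The set of sites of a box. -/
def Box.sites {d : ℕ} (Λ : Box d) : Finset (Fin d → ℤ) :=
  Fintype.piFinset fun j => Finset.Ico (Λ.corner j) (Λ.corner j + ((Λ.side : ℕ) : ℤ))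

/-- The translated box `Λ + z`. -/
def Box.translate {d : ℕ} (Λ : Box d) (z : Fin d → ℤ) : Box d := ⟨Λ.corner + z, Λ.side⟩

/-- The box `Λ(n) = [0, n[^d ∩ ℤ^d`. -/
def cube (d : ℕ) (n : ℕ+) : Box d := ⟨0, n⟩

/-- The configuration space `X^{ℤ^d}`. -/
abbrev Config (d : ℕ) (X : Type*) := (Fin d → ℤ) → X

/-- The translate `A + z = {σ(· - z) ; σ ∈ A}` of a set of configurations. -/
def shiftSet {d : ℕ} {X : Type*} (z : Fin d → ℤ) (A : Set (Config d X)) : Set (Config d X) :=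
  (fun σ v => σ (v - z)) '' A

/-- The block average `𝔪_Λ σ = |Λ|⁻¹ ∑_{z ∈ Λ} σ(z)`. -/
def blockMean {d : ℕ} {X : Type*} [AddCommGroup X] [Module ℝ X] (Λ : Box d) (σ : Config d X) : X :=
  (Λ.sites.card : ℝ)⁻¹ • ∑ z ∈ Λ.sites, σ z

/-- The σ-algebra `ℱ_S` generated by the block averages over the boxes included in `S`. -/
@[reducible] def siteSigma {d : ℕ} (X : Type*) [AddCommGroup X] [Module ℝ X] [mX : MeasurableSpace X]
    (S : Finset (Fin d → ℤ)) : MeasurableSpace (Config d X) :=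
  ⨆ (Λ : Box d) (_ : Λ.sites ⊆ S), MeasurableSpace.comap (blockMean Λ) mX

/-- A family `(μ_Λ)` where `μ_Λ` is a measure on the σ-algebra `ℱ_Λ`, for each box `Λ`. -/
abbrev BoxMeasures (d : ℕ) (X : Type*) [AddCommGroup X] [Module ℝ X] [MeasurableSpace X] :=
  (Λ : Box d) → @Measure (Config d X) (siteSigma X Λ.sites)

section Systems

variable {d : ℕ} {X : Type*} [AddCommGroup X] [Module ℝ X] [MeasurableSpace X]

/-- `(μ_Λ)` is a compatible system of translation invariant probability measures. -/
structure IsCompatibleInvariant (μ : BoxMeasures d X) : Prop where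
  prob : ∀ Λ : Box d, μ Λ Set.univ = 1
  compatible : ∀ Λ₁ Λ₂ : Box d, Λ₁.sites ⊆ Λ₂.sites →
    ∀ A, MeasurableSet[siteSigma X Λ₁.sites] A → μ Λ₂ A = μ Λ₁ A
  invariant : ∀ (Λ : Box d) (z : Fin d → ℤ),
    ∀ A, MeasurableSet[siteSigma X Λ.sites] A → μ (Λ.translate z) (shiftSet z A) = μ Λ A

/-- `(μ_Λ)` is carried by the (not necessarily measurable) set of configurations `E`. -/
def CarriedBy (μ : BoxMeasures d X) (E : Set (Config d X)) : Prop :=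
  ∀ (Λ : Box d) (A B : Set (Config d X)), MeasurableSet[siteSigma X Λ.sites] A →
    MeasurableSet[siteSigma X Λ.sites] B → A ∩ E = B ∩ E → μ Λ A = μ Λ B

/-- The configurations with values in `D`, that is `D^{ℤ^d}`. -/
def configsIn (d : ℕ) {X : Type*} (D : Set X) : Set (Config d X) := {σ | ∀ z, σ z ∈ D}

/-- Lower asymptotic decoupling. The condition `dist(S, Λ(m)) > g(m)`, for the distance of the sup
norm, is written pointwise (`S` and `Λ(m)` are finite), and `ℙ` is computed in any box that contains
`S` and `Λ(m)`. -/
def LowerDecoupled (μ : BoxMeasures d X) : Prop :=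
  ∃ g c : ℕ+ → ℝ, (∀ m, 0 ≤ g m) ∧ (∀ m, 0 ≤ c m) ∧
    Tendsto (fun m : ℕ+ => g m / ((m : ℕ) : ℝ)) atTop (𝓝 0) ∧
    Tendsto (fun m : ℕ+ => c m / ((cube d m).sites.card : ℝ)) atTop (𝓝 0) ∧
    ∀ (m : ℕ+) (S : Finset (Fin d → ℤ)),
      (∀ z ∈ S, ∀ w ∈ (cube d m).sites, g m < dist z w) →
      ∀ A B, MeasurableSet[siteSigma X (cube d m).sites] A → MeasurableSet[siteSigma X S] B →
        ∀ Λ : Box d, (cube d m).sites ⊆ Λ.sites → S ⊆ Λ.sites →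
          ENNReal.ofReal (Real.exp (-c m)) * μ Λ A * μ Λ B ≤ μ Λ (A ∩ B)

/-- The conditional probability `ℙ(σ(0) ∈ A | ℱ_{Λ ∖ {0}})`, for a box `Λ` containing `0`. -/
def condProbOrigin (μ : BoxMeasures d X) (Λ : Box d) (A : Set X) : Config d X → ℝ :=
  (μ Λ)⟦{σ : Config d X | σ 0 ∈ A} | siteSigma X (Λ.sites.erase 0)⟧

end Systems

/-! ### Measurable locally convex spaces -/

/-- The gauge `M_C(x) = inf {t ≥ 0 ; x ∈ tC}`, with values in `[0, ∞]`. -/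
def extGauge {X : Type*} [AddCommGroup X] [Module ℝ X] (C : Set X) (x : X) : ℝ≥0∞ :=
  ⨅ (t : ℝ≥0) (_ : x ∈ (t : ℝ) • C), (t : ℝ≥0∞)

/-- A convex set `C` is internal if its gauge is finite and `C = {M_C < 1}`. -/
structure IsInternalConvex {X : Type*} [AddCommGroup X] [Module ℝ X] (C : Set X) : Prop where
  convex : Convex ℝ C
  gauge_finite : ∀ x, extGauge C x < ∞
  eq_gauge_lt_one : C = {x | extGauge C x < 1}

/-- The set `𝒞₀(ℱ)` of measurable internal convex sets. -/
def measurableInternal (X : Type*) [AddCommGroup X] [Module ℝ X] [MeasurableSpace X] :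
    Set (Set X) :=
  {C | IsInternalConvex C ∧ MeasurableSet C}

/-- The σ-algebra of `X` is stable under dilations (of nonzero ratio) and translations. -/
structure StableSigma (X : Type*) [AddCommGroup X] [Module ℝ X] [MeasurableSpace X] : Prop where
  smul : ∀ (r : ℝ) (A : Set X), r ≠ 0 → MeasurableSet A → MeasurableSet (r • A)
  vadd : ∀ (x : X) (A : Set X), MeasurableSet A → MeasurableSet (x +ᵥ A)

/-- The family `𝒞_x = {x + C ; C ∈ 𝒞₀}`. -/
def translates {X : Type*} [AddCommGroup X] (C₀ : Set (Set X)) (x : X) : Set (Set X) :=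
  {A | ∃ C ∈ C₀, A = x +ᵥ C}

/-- The topology generated by the sets `x + C`, with `x ∈ X` and `C ∈ 𝒞₀`. -/
@[reducible] def familyTopology {X : Type*} [AddCommGroup X] (C₀ : Set (Set X)) : TopologicalSpace X :=
  TopologicalSpace.generateFrom {A | ∃ x, A ∈ translates C₀ x}

/-- The topological dual of `X` for the topology `τ`. -/
def dualOf {X : Type*} [AddCommGroup X] [Module ℝ X] (τ : TopologicalSpace X) :
    Set (X →ₗ[ℝ] ℝ) :=
  {ℓ | @Continuous X ℝ τ inferInstance ℓ}

/-- A measurable locally convex space `(X, 𝒞₀, ℱ, τ)`, where `τ` is the topology generated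
by `𝒞₀`. -/
structure MeasurableLCS (X : Type*) [AddCommGroup X] [Module ℝ X] [MeasurableSpace X] where
  C₀ : Set (Set X)
  stable : StableSigma X
  nonempty : C₀.Nonempty
  internal : C₀ ⊆ measurableInternal X
  symmetric : ∀ C ∈ C₀, -C = C
  inter : ∀ C ∈ C₀, ∀ C' ∈ C₀, C ∩ C' ∈ C₀
  dilate : ∀ r : ℝ, r ≠ 0 → ∀ C ∈ C₀, r • C ∈ C₀
  separated : ⋂₀ C₀ = {0}
  dual_measurable : ∀ ℓ ∈ dualOf (familyTopology C₀), Measurable ℓ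

/-- The topology `τ` of a measurable locally convex space. -/
@[reducible] def MeasurableLCS.topology {X : Type*} [AddCommGroup X] [Module ℝ X] [MeasurableSpace X]
    (E : MeasurableLCS X) : TopologicalSpace X :=
  familyTopology E.C₀

/-- A projective system `(Y i, f i, f_{ij})` of measurable locally convex spaces, with a source
space `X` whose σ-algebra is stable under dilations and translations. Here `trans` is `f_{ij}`. -/
structure ProjectiveSystem {J : Type*} [Preorder J] (X : Type*) [AddCommGroup X] [Module ℝ X]
    [MeasurableSpace X] (Y : J → Type*) [∀ i, AddCommGroup (Y i)] [∀ i, Module ℝ (Y i)]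
    [∀ i, MeasurableSpace (Y i)] where
  stable : StableSigma X
  space : ∀ i, MeasurableLCS (Y i)
  f : ∀ i, X →ₗ[ℝ] Y i
  f_measurable : ∀ i, Measurable (f i)
  trans : ∀ i j, i ≤ j → Y j →ₗ[ℝ] Y i
  trans_measurable : ∀ i j (h : i ≤ j), Measurable (trans i j h)
  trans_continuous : ∀ i j (h : i ≤ j),
    @Continuous (Y j) (Y i) (space j).topology (space i).topology (trans i j h)
  trans_self : ∀ i, trans i i le_rfl = LinearMap.id
  trans_f : ∀ i j (h : i ≤ j), trans i j h ∘ₗ f j = f i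
  trans_trans : ∀ i j k (h : i ≤ j) (h' : j ≤ k),
    trans i j h ∘ₗ trans j k h' = trans i k (h.trans h')

section Projective

variable {J : Type*} [Preorder J] {X : Type*} [AddCommGroup X] [Module ℝ X]
  [MeasurableSpace X] {Y : J → Type*} [∀ i, AddCommGroup (Y i)] [∀ i, Module ℝ (Y i)]
  [∀ i, MeasurableSpace (Y i)]

/-- The family `𝒞₀` of the projective limit: the sets `f_i⁻¹(C)`, with `C` in the family `𝒞_{0,i}`
of the space `Y i`. -/
def ProjectiveSystem.limitFamily (P : ProjectiveSystem X Y) : Set (Set X) :=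
  {A | ∃ i, ∃ C ∈ (P.space i).C₀, A = P.f i ⁻¹' C}

/-- The topology of the projective limit. -/
@[reducible] def ProjectiveSystem.limitTopology (P : ProjectiveSystem X Y) : TopologicalSpace X :=
  familyTopology P.limitFamily

end Projective

/-! ### Projected systems, local control, local convex-tightness -/

section Local

variable {d : ℕ} {X Y : Type*} [AddCommGroup X] [Module ℝ X] [MeasurableSpace X]
  [AddCommGroup Y] [Module ℝ Y] [MeasurableSpace Y]

/-- The map `f^{ℤ^d}` is measurable for the σ-algebras `ℱ_S`. -/
theorem measurable_configMap (f : X →ₗ[ℝ] Y) (hf : Measurable f) (S : Finset (Fin d → ℤ)) :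
    Measurable[siteSigma X S, siteSigma Y S] fun (σ : Config d X) z => f (σ z) := by
  rw [measurable_iff_comap_le]
  simp only [siteSigma, MeasurableSpace.comap_iSup, MeasurableSpace.comap_comp]
  refine iSup₂_le fun Λ hΛ => le_trans ?_ (le_iSup₂_of_le Λ hΛ le_rfl)
  have h : (blockMean Λ ∘ fun (σ : Config d X) z => f (σ z)) = f ∘ blockMean Λ := by
    funext σ
    simp [blockMean, map_sum]
  rw [h, ← MeasurableSpace.comap_comp]
  exact MeasurableSpace.comap_mono hf.comap_le

/-- The projected family `(μ_Λ ∘ (f^{ℤ^d})⁻¹)`. -/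
def BoxMeasures.proj (μ : BoxMeasures d X) (f : X → Y) : BoxMeasures d Y := fun Λ =>
  @Measure.map (Config d X) (Config d Y) (siteSigma X Λ.sites) (siteSigma Y Λ.sites)
    (fun σ z => f (σ z)) (μ Λ)

/-- Local control. -/
def LocallyControlled (μ : BoxMeasures d X) : Prop :=
  ∃ t α : measurableInternal X → ℝ, (∀ C, 0 < t C) ∧ (∀ C, 0 < α C) ∧
    ∀ (C : measurableInternal X) (Λ : Box d), (0 : Fin d → ℤ) ∈ Λ.sites →
      ∀ᵐ σ ∂(μ Λ), α C ≤ condProbOrigin μ Λ (t C • (C : Set X)) σ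

/-- Local convex-tightness on `D`, for the topology `τ`. -/
def LocallyConvexTight (τ : TopologicalSpace X) (μ : BoxMeasures d X) (D : Set X) : Prop :=
  ∀ γ : ℝ, 0 < γ → ∃ K : Set X, MeasurableSet K ∧ Convex ℝ (K ∩ D) ∧ IsCompact (closure (K ∩ D)) ∧
    ∀ Λ : Box d, (0 : Fin d → ℤ) ∈ Λ.sites →
      ∀ᵐ σ ∂(μ Λ), 1 - γ ≤ condProbOrigin μ Λ K σ

/-- The Cramér sequence `μ_n = μ_{Λ(n)} ∘ 𝔪_{Λ(n)}⁻¹`. -/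
def cramerSeq (μ : BoxMeasures d X) (n : ℕ+) : Measure X :=
  @Measure.map (Config d X) X (siteSigma X (cube d n).sites) _ (blockMean (cube d n))
    (μ (cube d n))

end Local

/-! ### Entropy, large deviations, pressure -/

/-- `|Λ(n)|⁻¹ log a`, for `a ∈ [0, ∞]`. -/
def logRate (d : ℕ) (n : ℕ+) (a : ℝ≥0∞) : EReal :=
  ENNReal.log a / ((cube d n).sites.card : EReal)

section LDP

variable {Z : Type*} [MeasurableSpace Z]

/-- The entropy `s(x) = inf_{C ∈ 𝒱 x} liminf_n |Λ(n)|⁻¹ log ν_n(C)` of a sequence of measures, for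
given families `𝒱 x` of neighbourhoods of the points. -/
def entropy (d : ℕ) (ν : ℕ+ → Measure Z) (𝒱 : Z → Set (Set Z)) (x : Z) : EReal :=
  ⨅ C ∈ 𝒱 x, liminf (fun n => logRate d n (ν n C)) atTop

/-- The weak upper bound relative to `D`: the large deviations upper bound for the measurable sets
`K` such that `K ∩ D` is relatively compact. -/
def WeakUpperBoundOn (d : ℕ) (τ : TopologicalSpace Z) (ν : ℕ+ → Measure Z) (s : Z → EReal)
    (D : Set Z) : Prop :=
  ∀ K : Set Z, MeasurableSet K → IsCompact (closure (K ∩ D)) →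
    limsup (fun n => logRate d n (ν n K)) atTop ≤ ⨆ x ∈ closure K, s x

/-- The weak large deviations principle with entropy `s` at speed `|Λ(n)|`: the lower bound for all
measurable sets and the upper bound for the relatively compact measurable sets. -/
def WeakLDP (d : ℕ) (τ : TopologicalSpace Z) (ν : ℕ+ → Measure Z) (s : Z → EReal) : Prop :=
  (∀ A : Set Z, MeasurableSet A →
    ⨆ x ∈ interior A, s x ≤ liminf (fun n => logRate d n (ν n A)) atTop) ∧
  WeakUpperBoundOn d τ ν s Set.univ

/-- The trace on `D` of a measure `ν`, on the trace σ-algebra: `A ∩ D ↦ ν^*(A ∩ D)`, with `ν^*` the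
outer measure of `ν` (the set `D` need not be measurable). -/
def traceMeasure (ν : Measure Z) (D : Set Z) : Measure D :=
  (OuterMeasure.comap ((↑) : D → Z) ν.toOuterMeasure).toMeasure (by
    rintro A ⟨B, hB, rfl⟩ T
    simp only [OuterMeasure.comap_apply]
    rw [Set.image_inter_preimage, Set.image_sdiff_preimage]
    exact le_toOuterMeasure_caratheodory ν B hB _)

/-- The traces on `D` of the members of the families `𝒱 x`. -/
def traceFamily (D : Set Z) (𝒱 : Z → Set (Set Z)) (x : D) : Set (Set D) :=
  {A | ∃ C ∈ 𝒱 x, A = ((↑) : D → Z) ⁻¹' C}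

end LDP

section Pressure

variable {X : Type*} [AddCommGroup X] [Module ℝ X] [MeasurableSpace X]

/-- `|Λ(n)|⁻¹ log ∫ exp(|Λ(n)| ⟨ℓ | x⟩) dν_n(x)`. -/
def logLaplace (d : ℕ) (ν : ℕ+ → Measure X) (ℓ : X →ₗ[ℝ] ℝ) (n : ℕ+) : EReal :=
  logRate d n (∫⁻ x, ENNReal.ofReal (Real.exp (((cube d n).sites.card : ℝ) * ℓ x)) ∂(ν n))

/-- The pressure of the sequence `(ν_n)`. -/
def pressure (d : ℕ) (ν : ℕ+ → Measure X) (ℓ : X →ₗ[ℝ] ℝ) : EReal :=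
  limsup (logLaplace d ν ℓ) atTop

end Pressure

end CramerField

end

/-! The engine is a one-sided independence estimate. A large cube Λ(n) is filled with translates of
Λ(m) at mutual distance greater than g(m), leaving a small proportion ε of sites. Decoupling bounds
the joint probability of events in the blocks below by the product of their probabilities, at a cost
c(m) per block. Local control then forces the leftover sites into a fixed ball of a seminorm, at a
cost κ per site. The total cost is exp(-ε(1+κ)|Λ(n)|) (`eventually_layout_lintegral_le`).

Three uses of this estimate give the results on a single space. Asking a proportion t of the blocks
to have mean near x and the others near x' puts the mean over Λ(n) near tx+(1-t)x'
(`eventually_le_cramerSeq_ball`). With x = x' this bounds the limsup of the rates on a ball by the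
liminf on the ball of double radius (`RuelleLanford`), and finite covers then give the weak upper
bound; with x ≠ x' it gives concavity of s. Applied to exponentials of a linear form instead of
indicators, the estimate makes the exponential moments almost supermultiplicative
(`eventually_le_lintegral_tilt`), so the pressure is a limit. The inequality p(ℓ) - s(x) ≥ ℓ(x)
comes from restricting the exponential integral to a small ball around x.

For the equality s = -p*, Hahn–Banach separates the hypograph of s, which is concave and upper
semicontinuous, from a point above it. It remains to prove p(ℓ) ≤ sup(ℓ+s)
(`pressure_le_of_forall`). Tightness replaces the exponential moment by one where all sites lie in a
set K with K ∩ D convex and relatively compact. Convexity keeps the block means in K ∩ D, where a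
finite cover by small neighbourhoods bounds the integral.

The projective limit adds little: each basic neighbourhood is pulled back from a single Y_i, and
each continuous linear form factors through a continuous form on a single Y_i
(`ProjectiveSystem.exists_factor`). Hence s is the infimum of the projected entropies, and every
claim is read at one index. -/

noncomputable section

namespace CramerField

/-! ### Comparison of integrals over sub-σ-algebras -/

section Generic

variable {Ω : Type*} {m m' m0 : MeasurableSpace Ω} {μ : @Measure Ω m0}

/-- An inequality between measures on a sub-σ-algebra extends to integrals. -/
theorem const_mul_lintegral_le_of_trim (hm : m ≤ m0) {μ ν : @Measure Ω m0} {a : ℝ≥0∞}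
    (h : ∀ B, MeasurableSet[m] B → a * μ B ≤ ν B) {G : Ω → ℝ≥0∞} (hG : Measurable[m] G) :
    a * ∫⁻ ω, G ω ∂μ ≤ ∫⁻ ω, G ω ∂ν := by
  rw [← lintegral_trim hm hG, ← lintegral_trim hm hG, ← smul_eq_mul, ← lintegral_smul_measure]
  refine lintegral_mono' (Measure.le_iff.2 fun B hB => ?_) le_rfl
  rw [Measure.smul_apply, trim_measurableSet_eq hm hB, trim_measurableSet_eq hm hB, smul_eq_mul]
  exact h B hB

/-- An inequality `a μ(B) ≤ μ(s ∩ B)`, for `B` in a sub-σ-algebra, extends to integrals. -/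
theorem const_mul_lintegral_le_indicator (hm : m ≤ m0) {s : Set Ω} (hs : MeasurableSet[m0] s)
    {a : ℝ≥0∞} (h : ∀ B, MeasurableSet[m] B → a * μ B ≤ μ (s ∩ B)) {G : Ω → ℝ≥0∞}
    (hG : Measurable[m] G) :
    a * ∫⁻ ω, G ω ∂μ ≤ ∫⁻ ω, s.indicator 1 ω * G ω ∂μ := by
  refine (const_mul_lintegral_le_of_trim hm (ν := μ.restrict s) ?_ hG).trans_eq ?_
  · intro B hB
    rw [Measure.restrict_apply (hm B hB), Set.inter_comm]
    exact h B hB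
  · rw [← lintegral_indicator hs]
    refine lintegral_congr fun ω => ?_
    by_cases hω : ω ∈ s <;> simp [hω]

/-- A decoupling inequality for events extends to functions. -/
theorem lintegral_mul_lintegral_le (hm : m ≤ m0) (hm' : m' ≤ m0) {a : ℝ≥0∞}
    (h : ∀ A B, MeasurableSet[m] A → MeasurableSet[m'] B → a * μ A * μ B ≤ μ (A ∩ B))
    {F G : Ω → ℝ≥0∞} (hF : Measurable[m] F) (hG : Measurable[m'] G) :
    a * (∫⁻ ω, F ω ∂μ) * ∫⁻ ω, G ω ∂μ ≤ ∫⁻ ω, F ω * G ω ∂μ := by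
  -- One factor at a time: with `A` fixed, `B` is replaced by `G`. The result compares two measures
  -- in `A`, one of density `G`, so `A` can then be replaced by `F`.
  have h1 : ∀ A, MeasurableSet[m] A →
      (a * ∫⁻ ω, G ω ∂μ) * μ A ≤ (μ.withDensity G) A := by
    intro A hA
    have h2 := const_mul_lintegral_le_indicator hm' (hm A hA) (a := a * μ A)
      (fun B hB => h A B hA hB) hG
    rw [withDensity_apply _ (hm A hA), ← lintegral_indicator (hm A hA)]
    calc (a * ∫⁻ ω, G ω ∂μ) * μ A = a * μ A * ∫⁻ ω, G ω ∂μ := by ring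
      _ ≤ _ := h2
      _ = _ := by
        refine lintegral_congr fun ω => ?_
        by_cases hω : ω ∈ A <;> simp [hω]
  have h3 := const_mul_lintegral_le_of_trim hm h1 hF
  rw [lintegral_withDensity_eq_lintegral_mul _ (hG.mono hm' le_rfl) (hF.mono hm le_rfl)] at h3
  calc a * (∫⁻ ω, F ω ∂μ) * ∫⁻ ω, G ω ∂μ = a * (∫⁻ ω, G ω ∂μ) * ∫⁻ ω, F ω ∂μ := by ring
    _ ≤ _ := h3
    _ = _ := by simp [mul_comm]

/-- A lower bound on a conditional probability, integrated over conditioning events. -/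
theorem ofReal_mul_le_of_le_condExp [IsProbabilityMeasure μ] (hm : m ≤ m0) {s : Set Ω}
    (hs : MeasurableSet[m0] s) {α : ℝ} (hα : ∀ᵐ ω ∂μ, α ≤ (μ⟦s | m⟧) ω) {B : Set Ω}
    (hB : MeasurableSet[m] B) : ENNReal.ofReal α * μ B ≤ μ (s ∩ B) := by
  have hB0 := hm B hB
  have hint : Integrable (s.indicator fun _ => (1 : ℝ)) μ := (integrable_const 1).indicator hs
  have h1 := setIntegral_condExp hm hint hB
  rw [setIntegral_indicator hs, setIntegral_const, smul_eq_mul, mul_one, Set.inter_comm] at h1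
  have h2 : α * μ.real B ≤ μ.real (s ∩ B) := by
    rw [← h1]
    calc α * μ.real B = ∫ _ω in B, α ∂μ := by rw [setIntegral_const, smul_eq_mul, mul_comm]
      _ ≤ _ := integral_mono_ae (integrable_const α).integrableOn
          integrable_condExp.integrableOn (ae_restrict_of_ae hα)
  rw [← ofReal_measureReal (μ := μ) (s := B), ← ENNReal.ofReal_mul' measureReal_nonneg,
    ← ofReal_measureReal (μ := μ) (s := s ∩ B)]
  exact ENNReal.ofReal_le_ofReal h2

end Generic

/-! ### Shifts of configurations -/

section Shift

variable {d : ℕ} {X : Type*}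

/-- The shift `σ ↦ σ(· + z)`. -/
def shift (z : Fin d → ℤ) (σ : Config d X) : Config d X := fun v => σ (v + z)

theorem shiftSet_eq_preimage (z : Fin d → ℤ) (A : Set (Config d X)) :
    shiftSet z A = shift z ⁻¹' A := by
  ext σ
  constructor
  · rintro ⟨σ', h, rfl⟩
    have h1 : shift z (fun v => σ' (v - z)) = σ' := funext fun v => by simp [shift]
    rwa [Set.mem_preimage, h1]
  · intro h
    exact ⟨shift z σ, h, by funext v; simp [shift]⟩

theorem shift_zero (σ : Config d X) : shift 0 σ = σ := funext fun v => by simp [shift]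

theorem Box.mem_sites {Λ : Box d} {v : Fin d → ℤ} :
    v ∈ Λ.sites ↔ ∀ j, Λ.corner j ≤ v j ∧ v j < Λ.corner j + ((Λ.side : ℕ) : ℤ) := by
  simp [Box.sites]

theorem Box.mem_sites_translate {Λ : Box d} {z v : Fin d → ℤ} :
    v ∈ (Λ.translate z).sites ↔ v - z ∈ Λ.sites := by
  simp only [Box.mem_sites, Box.translate, Pi.add_apply, Pi.sub_apply]
  exact forall_congr' fun j => by constructor <;> rintro ⟨h1, h2⟩ <;> constructor <;> linarith

theorem Box.card_sites (Λ : Box d) : Λ.sites.card = (Λ.side : ℕ) ^ d := by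
  simp [Box.sites]

theorem Box.sites_translate (Λ : Box d) (z : Fin d → ℤ) :
    (Λ.translate z).sites = Λ.sites.map (addRightEmbedding z) := by
  ext v
  simp only [Box.mem_sites_translate, Finset.mem_map, addRightEmbedding_apply]
  constructor
  · intro h
    exact ⟨_, h, by simp⟩
  · rintro ⟨a, h, rfl⟩
    simpa using h

theorem card_cube (n : ℕ+) : (cube d n).sites.card = (n : ℕ) ^ d := Box.card_sites _

variable [AddCommGroup X] [Module ℝ X]

theorem blockMean_shift (Λ : Box d) (z : Fin d → ℤ) (σ : Config d X) :
    blockMean Λ (shift z σ) = blockMean (Λ.translate z) σ := by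
  simp [blockMean, shift, Box.sites_translate]

theorem blockMean_singleton (z : Fin d → ℤ) (σ : Config d X) :
    blockMean ⟨z, 1⟩ σ = σ z := by
  have h : (Box.sites ⟨z, 1⟩ : Finset (Fin d → ℤ)) = {z} := by
    ext v
    simp only [Box.mem_sites, PNat.one_coe, Nat.cast_one, Finset.mem_singleton]
    constructor
    · intro h
      funext j
      have := h j
      omega
    · rintro rfl j
      omega
  simp [blockMean, h]

variable [MeasurableSpace X]

theorem siteSigma_mono {S S' : Finset (Fin d → ℤ)} (h : S ⊆ S') :
    siteSigma X S ≤ siteSigma X S' :=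
  iSup₂_le fun Λ hΛ => le_iSup₂_of_le Λ (hΛ.trans h) le_rfl

theorem measurable_blockMean {S : Finset (Fin d → ℤ)} {Λ : Box d} (h : Λ.sites ⊆ S) :
    Measurable[siteSigma X S] (blockMean Λ : Config d X → X) :=
  measurable_iff_comap_le.2 (le_iSup₂_of_le Λ h le_rfl)

theorem measurable_eval_site {S : Finset (Fin d → ℤ)} {z : Fin d → ℤ} (h : z ∈ S) :
    Measurable[siteSigma X S] (fun σ : Config d X => σ z) := by
  have h1 : (fun σ : Config d X => σ z) = blockMean ⟨z, 1⟩ := by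
    funext σ
    rw [blockMean_singleton]
  rw [h1]
  refine measurable_blockMean fun v hv => ?_
  have : v = z := by
    funext j
    have := Box.mem_sites.1 hv j
    simp only [PNat.one_coe, Nat.cast_one] at this
    omega
  exact this ▸ h

theorem measurable_shift {S S' : Finset (Fin d → ℤ)} {z : Fin d → ℤ}
    (h : ∀ v ∈ S, v + z ∈ S') :
    Measurable[siteSigma X S', siteSigma X S] (shift z : Config d X → Config d X) := by
  rw [measurable_iff_comap_le]
  simp only [siteSigma, MeasurableSpace.comap_iSup, MeasurableSpace.comap_comp]
  refine iSup₂_le fun Λ hΛ => ?_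
  have h1 : (blockMean Λ ∘ shift z : Config d X → X) = blockMean (Λ.translate z) :=
    funext fun σ => blockMean_shift Λ z σ
  rw [h1]
  refine le_iSup₂_of_le (Λ.translate z) (fun v hv => ?_) le_rfl
  have := h _ (hΛ (Box.mem_sites_translate.1 hv))
  simpa using this

end Shift

/-! ### Compatible systems -/

section Compatible

variable {d : ℕ} {X : Type*} [AddCommGroup X] [Module ℝ X] [MeasurableSpace X]
  {μ : BoxMeasures d X}

theorem IsCompatibleInvariant.isProbabilityMeasure (hμ : IsCompatibleInvariant μ) (Λ : Box d) :
    IsProbabilityMeasure (μ Λ) := ⟨hμ.prob Λ⟩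

theorem IsCompatibleInvariant.measure_shift (hμ : IsCompatibleInvariant μ) (Λ : Box d)
    (z : Fin d → ℤ) {A : Set (Config d X)} (hA : MeasurableSet[siteSigma X Λ.sites] A) :
    μ (Λ.translate z) (shift z ⁻¹' A) = μ Λ A := by
  rw [← shiftSet_eq_preimage]
  exact hμ.invariant Λ z A hA

theorem IsCompatibleInvariant.measure_shift_of_subset (hμ : IsCompatibleInvariant μ)
    {Λ Λ' : Box d} {z : Fin d → ℤ} (h : ∀ v ∈ Λ.sites, v + z ∈ Λ'.sites)
    {A : Set (Config d X)} (hA : MeasurableSet[siteSigma X Λ.sites] A) :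
    μ Λ' (shift z ⁻¹' A) = μ Λ A := by
  rw [← hμ.measure_shift Λ z hA]
  refine hμ.compatible _ _ (fun v hv => ?_) _ ?_
  · simpa using h _ (Box.mem_sites_translate.1 hv)
  · exact measurable_shift (fun v hv => Box.mem_sites_translate.2 (by simpa using hv)) hA

theorem IsCompatibleInvariant.lintegral_shift (hμ : IsCompatibleInvariant μ)
    {Λ Λ' : Box d} {z : Fin d → ℤ} (h : ∀ v ∈ Λ.sites, v + z ∈ Λ'.sites)
    {F : Config d X → ℝ≥0∞} (hF : Measurable[siteSigma X Λ.sites] F) :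
    ∫⁻ σ, F (shift z σ) ∂(μ Λ') = ∫⁻ σ, F σ ∂(μ Λ) := by
  rw [← @lintegral_map _ _ (siteSigma X Λ'.sites) (siteSigma X Λ.sites) (μ Λ') F (shift z) hF
    (measurable_shift h)]
  congr 1
  refine @Measure.ext _ (siteSigma X Λ.sites) _ _ fun A hA => ?_
  rw [Measure.map_apply (measurable_shift h) hA]
  exact hμ.measure_shift_of_subset h hA

/-- The inequality `α ℙ(B) ≤ ℙ({σ(0) ∈ Q} ∩ B)` for every `B` in some `ℱ_{Λ ∖ {0}}`. -/
def LocalLowerBound (μ : BoxMeasures d X) (Q : Set X) (α : ℝ≥0∞) : Prop :=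
  ∀ Λ : Box d, (0 : Fin d → ℤ) ∈ Λ.sites →
    ∀ B, MeasurableSet[siteSigma X (Λ.sites.erase 0)] B →
      α * μ Λ B ≤ μ Λ ({σ | σ 0 ∈ Q} ∩ B)

theorem IsCompatibleInvariant.localLowerBound (hμ : IsCompatibleInvariant μ) {Q : Set X}
    (hQ : MeasurableSet Q) {α : ℝ} (h : ∀ Λ : Box d, (0 : Fin d → ℤ) ∈ Λ.sites →
      ∀ᵐ σ ∂(μ Λ), α ≤ condProbOrigin μ Λ Q σ) :
    LocalLowerBound μ Q (ENNReal.ofReal α) := by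
  intro Λ h0 B hB
  have := hμ.isProbabilityMeasure Λ
  exact ofReal_mul_le_of_le_condExp (siteSigma_mono (Finset.erase_subset _ _))
    (measurable_eval_site h0 hQ) (h Λ h0) hB

/-- Invariance carries the bound from the origin to any site, by translating the box by `-z`. -/
theorem LocalLowerBound.translate (hμ : IsCompatibleInvariant μ) {Q : Set X} {α : ℝ≥0∞}
    (hQ : MeasurableSet Q) (h : LocalLowerBound μ Q α) {Λ : Box d} {z : Fin d → ℤ}
    (hz : z ∈ Λ.sites) {B : Set (Config d X)}
    (hB : MeasurableSet[siteSigma X (Λ.sites.erase z)] B) :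
    α * μ Λ B ≤ μ Λ ({σ | σ z ∈ Q} ∩ B) := by
  have h0 : (0 : Fin d → ℤ) ∈ (Λ.translate (-z)).sites := Box.mem_sites_translate.2 (by simpa)
  have hsub : ∀ v ∈ Λ.sites, v + -z ∈ (Λ.translate (-z)).sites := fun v hv =>
    Box.mem_sites_translate.2 (by simpa using hv)
  have hB' : MeasurableSet[siteSigma X ((Λ.translate (-z)).sites.erase 0)] (shift (-z) ⁻¹' B) := by
    refine measurable_shift (fun v hv => ?_) hB
    rw [Finset.mem_erase] at hv ⊢
    refine ⟨fun h => hv.1 ?_, hsub _ hv.2⟩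
    rwa [add_neg_eq_zero] at h
  have hBm := siteSigma_mono (X := X) (Finset.erase_subset _ _) _ hB
  have hE : MeasurableSet[siteSigma X Λ.sites] ({σ | σ z ∈ Q} : Set (Config d X)) :=
    measurable_eval_site hz hQ
  have key := h _ h0 _ hB'
  rw [hμ.measure_shift_of_subset hsub hBm] at key
  have h2 : ({σ | σ 0 ∈ Q} ∩ shift (-z) ⁻¹' B : Set (Config d X)) =
      shift (-z) ⁻¹' ({σ | σ z ∈ Q} ∩ B) := by
    ext σ
    simp [shift]
  rwa [h2, hμ.measure_shift_of_subset hsub (hE.inter hBm)] at key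

theorem LocalLowerBound.const_mul_lintegral_le (hμ : IsCompatibleInvariant μ) {Q : Set X}
    {α : ℝ≥0∞} (hQ : MeasurableSet Q) (h : LocalLowerBound μ Q α) {Λ : Box d} {z : Fin d → ℤ}
    (hz : z ∈ Λ.sites) {G : Config d X → ℝ≥0∞}
    (hG : Measurable[siteSigma X (Λ.sites.erase z)] G) :
    α * ∫⁻ σ, G σ ∂(μ Λ) ≤ ∫⁻ σ, Q.indicator 1 (σ z) * G σ ∂(μ Λ) :=
  const_mul_lintegral_le_indicator (siteSigma_mono (Finset.erase_subset _ _))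
    (measurable_eval_site hz hQ) (fun _ hB => h.translate hμ hQ hz hB) hG

/-- Local lower bounds for `Q` and `K` combine into a bound for `Q ∩ K`. -/
theorem LocalLowerBound.inter (hμ : IsCompatibleInvariant μ) {Q K : Set X} {α β γ : ℝ≥0∞}
    (hK : MeasurableSet K) (hQ : LocalLowerBound μ Q α) (hK' : LocalLowerBound μ K β)
    (hβ : 1 ≤ β + γ) (hβ1 : β ≠ ∞) : LocalLowerBound μ (Q ∩ K) (α - γ) := by
  intro Λ h0 B hB
  have := hμ.isProbabilityMeasure Λ
  have h1 := hQ Λ h0 B hB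
  have h2 := hK' Λ h0 B hB
  have hKm : MeasurableSet[siteSigma X Λ.sites] ({σ | σ 0 ∈ K} : Set (Config d X)) :=
    measurable_eval_site h0 hK
  -- `K` keeps at least the share `β` of `B`, so it loses at most the share `γ`; finiteness of `β`
  -- allows the cancellation.
  have h3 : μ Λ (B \ {σ | σ 0 ∈ K}) ≤ γ * μ Λ B := by
    have h4 := measure_inter_add_sdiff (μ := μ Λ) B hKm
    rw [Set.inter_comm] at h4
    have h5 : β * μ Λ B + μ Λ (B \ {σ | σ 0 ∈ K}) ≤ β * μ Λ B + γ * μ Λ B :=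
      calc _ ≤ μ Λ ({σ | σ 0 ∈ K} ∩ B) + μ Λ (B \ {σ | σ 0 ∈ K}) := by gcongr
        _ = 1 * μ Λ B := by rw [h4, one_mul]
        _ ≤ (β + γ) * μ Λ B := by gcongr
        _ = _ := add_mul _ _ _
    exact (ENNReal.add_le_add_iff_left
      (ENNReal.mul_ne_top hβ1 (measure_ne_top _ _))).1 h5
  rw [ENNReal.sub_mul (fun _ _ => measure_ne_top _ _), tsub_le_iff_right]
  calc α * μ Λ B ≤ μ Λ ({σ | σ 0 ∈ Q} ∩ B) := h1
    _ ≤ μ Λ (({σ | σ 0 ∈ Q ∩ K} ∩ B) ∪ (B \ {σ | σ 0 ∈ K})) := by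
      refine measure_mono fun σ hσ => ?_
      by_cases hk : σ 0 ∈ K
      · exact Or.inl ⟨⟨hσ.1, hk⟩, hσ.2⟩
      · exact Or.inr ⟨hσ.2, hk⟩
    _ ≤ _ := (measure_union_le _ _).trans (by gcongr)

/-- Decoupling of functions, for a translate of `Λ(m)`. -/
theorem IsCompatibleInvariant.decoupled_lintegral (hμ : IsCompatibleInvariant μ) {m : ℕ+}
    {g c : ℝ} (hdec : ∀ S : Finset (Fin d → ℤ),
      (∀ z ∈ S, ∀ w ∈ (cube d m).sites, g < dist z w) →
      ∀ A B, MeasurableSet[siteSigma X (cube d m).sites] A → MeasurableSet[siteSigma X S] B →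
        ∀ Λ : Box d, (cube d m).sites ⊆ Λ.sites → S ⊆ Λ.sites →
          ENNReal.ofReal (Real.exp (-c)) * μ Λ A * μ Λ B ≤ μ Λ (A ∩ B))
    {Λ : Box d} {S : Finset (Fin d → ℤ)} {z : Fin d → ℤ} (hS : S ⊆ Λ.sites)
    (hz : ∀ v ∈ (cube d m).sites, v + z ∈ Λ.sites)
    (hdist : ∀ v ∈ S, ∀ w ∈ (cube d m).sites, g < dist v (w + z))
    {F G : Config d X → ℝ≥0∞} (hF : Measurable[siteSigma X (cube d m).sites] F)
    (hG : Measurable[siteSigma X S] G) :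
    ENNReal.ofReal (Real.exp (-c)) * (∫⁻ σ, F σ ∂(μ (cube d m))) * ∫⁻ σ, G σ ∂(μ Λ) ≤
      ∫⁻ σ, F (shift z σ) * G σ ∂(μ Λ) := by
  have hsub : ∀ v ∈ Λ.sites, v + -z ∈ (Λ.translate (-z)).sites := fun v hv =>
    Box.mem_sites_translate.2 (by simpa using hv)
  have hcube : (cube d m).sites ⊆ (Λ.translate (-z)).sites := fun v hv =>
    Box.mem_sites_translate.2 (by simpa using hz v hv)
  -- The hypothesis concerns only the block at the origin, so everything is translated by `-z`.
  set S' := S.map (addRightEmbedding (-z)) with hS'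
  have hG' : Measurable[siteSigma X S'] fun σ => G (shift (-z) σ) :=
    hG.comp (measurable_shift fun v hv => by simpa [hS'] using hv)
  have hSS : S' ⊆ (Λ.translate (-z)).sites := fun v hv => by
    obtain ⟨w, hw, rfl⟩ := Finset.mem_map.1 hv
    exact hsub w (hS hw)
  have key := lintegral_mul_lintegral_le (μ := μ (Λ.translate (-z))) (siteSigma_mono hcube)
    (siteSigma_mono hSS) (a := ENNReal.ofReal (Real.exp (-c)))
    (fun A B hA hB => hdec S' (fun v hv w hw => by
      obtain ⟨u, hu, rfl⟩ := Finset.mem_map.1 hv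
      have := hdist u hu w hw
      rwa [← dist_add_right _ _ (-z), add_neg_cancel_right] at this)
      A B hA hB _ hcube hSS) hF hG'
  have e1 : ∫⁻ σ, F σ ∂(μ (Λ.translate (-z))) = ∫⁻ σ, F σ ∂(μ (cube d m)) := by
    have := hμ.lintegral_shift (Λ := cube d m) (Λ' := Λ.translate (-z)) (z := 0)
      (fun v hv => by simpa using hcube hv) hF
    rw [← this]
    exact lintegral_congr fun σ => by simp [shift_zero]
  have e2 : ∫⁻ σ, G (shift (-z) σ) ∂(μ (Λ.translate (-z))) = ∫⁻ σ, G σ ∂(μ Λ) :=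
    hμ.lintegral_shift hsub (hG.mono (siteSigma_mono hS) le_rfl)
  have hFz : Measurable[siteSigma X Λ.sites] fun σ => F (shift z σ) :=
    hF.comp (measurable_shift hz)
  have e3 := hμ.lintegral_shift hsub
    (hFz.mul (hG.mono (siteSigma_mono hS) le_rfl))
  have e4 : ∀ σ : Config d X, shift z (shift (-z) σ) = σ := fun σ => by
    funext v
    simp [shift]
  simp only [Pi.mul_apply, e4] at e3
  rwa [e1, e2, e3] at key

end Compatible

/-! ### Exponential rates -/

section Rates

/-- The number `|Λ(n)|`, as a real number. -/
def vol (d : ℕ) (n : ℕ+) : ℝ := ((cube d n).sites.card : ℝ)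

/-- The number `exp(r |Λ(n)|)`, in `[0, ∞]`. -/
def expVol (d : ℕ) (r : ℝ) (n : ℕ+) : ℝ≥0∞ := ENNReal.ofReal (Real.exp (r * vol d n))

variable {d : ℕ}

theorem vol_eq (n : ℕ+) : vol d n = ((n : ℕ) : ℝ) ^ d := by simp [vol, card_cube]

theorem vol_pos (n : ℕ+) : 0 < vol d n := by
  rw [vol_eq]
  have : 0 < ((n : ℕ) : ℝ) := by exact_mod_cast n.pos
  positivity

theorem tendsto_coe_pnat : Tendsto (fun n : ℕ+ => ((n : ℕ) : ℝ)) atTop atTop :=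
  tendsto_natCast_atTop_atTop.comp tendsto_PNat_val_atTop_atTop

theorem tendsto_vol (hd : 0 < d) : Tendsto (vol d) atTop atTop := by
  have : vol d = fun n : ℕ+ => ((n : ℕ) : ℝ) ^ d := funext vol_eq
  rw [this]
  exact (tendsto_pow_atTop hd.ne').comp tendsto_coe_pnat

theorem expVol_add (r s : ℝ) (n : ℕ+) : expVol d (r + s) n = expVol d r n * expVol d s n := by
  rw [expVol, add_mul, Real.exp_add, ENNReal.ofReal_mul (Real.exp_pos _).le]
  rfl

theorem expVol_pos (r : ℝ) (n : ℕ+) : 0 < expVol d r n := ENNReal.ofReal_pos.2 (Real.exp_pos _)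

theorem expVol_ne_top (r : ℝ) (n : ℕ+) : expVol d r n ≠ ∞ := ENNReal.ofReal_ne_top

theorem logRate_mono {n : ℕ+} {a b : ℝ≥0∞} (h : a ≤ b) : logRate d n a ≤ logRate d n b :=
  EReal.div_le_div_right_of_nonneg (by positivity) (ENNReal.log_le_log h)

theorem logRate_expVol (r : ℝ) (n : ℕ+) : logRate d n (expVol d r n) = r := by
  have h : ((cube d n).sites.card : EReal) = ((vol d n : ℝ) : EReal) := by simp [vol]
  rw [logRate, expVol, ENNReal.log_ofReal_of_pos (Real.exp_pos _), Real.log_exp, h,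
    ← EReal.coe_div, mul_div_assoc, div_self (vol_pos n).ne', mul_one]

theorem logRate_strictMono (n : ℕ+) : StrictMono (logRate d n) := by
  have h : ((cube d n).sites.card : EReal) = ((vol d n : ℝ) : EReal) := by simp [vol]
  intro a b hab
  rw [logRate, logRate, h]
  exact EReal.strictMono_div_right_of_pos (by exact_mod_cast vol_pos n) (EReal.coe_ne_top _)
    (ENNReal.log_lt_log hab)

/-- This comparison and the next two turn statements about rates into exponential bounds in `ℝ≥0∞`,
where the estimates are made. -/
theorem coe_le_logRate {r : ℝ} {n : ℕ+} {a : ℝ≥0∞} :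
    (r : EReal) ≤ logRate d n a ↔ expVol d r n ≤ a := by
  rw [← logRate_expVol (d := d) r n, (logRate_strictMono n).le_iff_le]

theorem logRate_le_coe {r : ℝ} {n : ℕ+} {a : ℝ≥0∞} :
    logRate d n a ≤ (r : EReal) ↔ a ≤ expVol d r n := by
  rw [← logRate_expVol (d := d) r n, (logRate_strictMono n).le_iff_le]

theorem coe_lt_logRate {r : ℝ} {n : ℕ+} {a : ℝ≥0∞} :
    (r : EReal) < logRate d n a ↔ expVol d r n < a := by
  rw [← logRate_expVol (d := d) r n, (logRate_strictMono n).lt_iff_lt]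

end Rates

/-! ### Layouts of a large cube by separated translates of a small one -/

section Layout

variable {d : ℕ}

/-- The sites of `Λ(n)` that are in no `Λ(m) + z`, for `z ∈ J`. -/
def restSites (m n : ℕ+) (J : Finset (Fin d → ℤ)) : Finset (Fin d → ℤ) :=
  (cube d n).sites \ J.biUnion fun z => ((cube d m).translate z).sites

/-- The cubes `Λ(m) + z`, for `z ∈ J`, are included in `Λ(n)`, at distances larger than `g`. -/
structure IsLayout (g : ℝ) (m n : ℕ+) (J : Finset (Fin d → ℤ)) : Prop where
  mem : ∀ z ∈ J, ∀ v ∈ (cube d m).sites, v + z ∈ (cube d n).sites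
  far : ∀ z ∈ J, ∀ z' ∈ J, z ≠ z' → ∀ v ∈ (cube d m).sites, ∀ w ∈ (cube d m).sites,
    g < dist (v + z) (w + z')

theorem IsLayout.sum_eq {g : ℝ} (hg : 0 ≤ g) {m n : ℕ+} {J : Finset (Fin d → ℤ)}
    (hJ : IsLayout g m n J) {M : Type*} [AddCommMonoid M] (h : (Fin d → ℤ) → M) :
    ∑ v ∈ (cube d n).sites, h v =
      ∑ z ∈ J, ∑ v ∈ (cube d m).sites, h (v + z) + ∑ v ∈ restSites m n J, h v := by
  have hsub : (J.biUnion fun z => ((cube d m).translate z).sites) ⊆ (cube d n).sites := by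
    intro v hv
    obtain ⟨z, hz, hv⟩ := Finset.mem_biUnion.1 hv
    simpa using hJ.mem z hz _ (Box.mem_sites_translate.1 hv)
  rw [restSites, ← Finset.sum_sdiff hsub, add_comm, Finset.sum_biUnion]
  · simp [Box.sites_translate]
  · intro z hz z' hz' hne
    refine Finset.disjoint_left.2 fun v hv hv' => ?_
    -- A site common to two blocks would give `g < 0`.
    have := hJ.far z hz z' hz' hne _ (Box.mem_sites_translate.1 hv) _
      (Box.mem_sites_translate.1 hv')
    simp only [sub_add_cancel, dist_self] at this
    linarith

theorem IsLayout.vol_eq {g : ℝ} (hg : 0 ≤ g) {m n : ℕ+} {J : Finset (Fin d → ℤ)}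
    (hJ : IsLayout g m n J) : vol d n = J.card * vol d m + (restSites m n J).card := by
  have := hJ.sum_eq hg (fun _ => (1 : ℝ))
  simpa [vol] using this

/-- The regular layout, with period `L`. -/
theorem exists_isLayout (m n : ℕ+) {L : ℕ} (hL : (m : ℕ) ≤ L) {g : ℝ} (hg : g < L - m + 1) :
    ∃ J : Finset (Fin d → ℤ), IsLayout g m n J ∧ J.card = (n / L : ℕ) ^ d := by
  have hL0 : 0 < L := m.pos.trans_le hL
  set q : ℕ := n / L
  have hqL : q * L ≤ n := Nat.div_mul_le_self _ _
  let e : ℤ ↪ ℤ := ⟨fun a => a * L, fun a b hab => by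
    have : (L : ℤ) ≠ 0 := by exact_mod_cast hL0.ne'
    exact mul_right_cancel₀ this hab⟩
  have hmem : ∀ z, z ∈ (Fintype.piFinset fun _ : Fin d => (Finset.Ico (0 : ℤ) q).map e) ↔
      ∀ j, ∃ a : ℤ, 0 ≤ a ∧ a < q ∧ a * L = z j := by
    intro z
    simp only [Fintype.mem_piFinset, Finset.mem_map, Finset.mem_Ico, and_assoc]
    rfl
  refine ⟨Fintype.piFinset fun _ => (Finset.Ico (0 : ℤ) q).map e, ⟨?_, ?_⟩, by simp⟩
  · intro z hz v hv
    rw [hmem] at hz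
    rw [Box.mem_sites] at hv ⊢
    intro j
    obtain ⟨a, ha0, haq, haz⟩ := hz j
    have hvj := hv j
    simp only [cube, Pi.zero_apply, zero_add, Pi.add_apply] at hvj ⊢
    have h1 : (a + 1) * (L : ℤ) ≤ q * L := by
      have : a + 1 ≤ q := haq
      exact mul_le_mul_of_nonneg_right this (by positivity)
    have h2 : (q : ℤ) * L ≤ (n : ℕ) := by exact_mod_cast hqL
    have h3 : ((m : ℕ) : ℤ) ≤ L := by exact_mod_cast hL
    have h4 : 0 ≤ a * (L : ℤ) := by positivity
    constructor <;> nlinarith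
  · intro z hz z' hz' hne v hv w hw
    rw [hmem] at hz hz'
    rw [Box.mem_sites] at hv hw
    obtain ⟨j, hj⟩ := Function.ne_iff.1 hne
    obtain ⟨a, -, -, haz⟩ := hz j
    obtain ⟨b, -, -, hbz⟩ := hz' j
    have hvj := hv j
    have hwj := hw j
    simp only [cube, Pi.zero_apply, zero_add] at hvj hwj
    refine lt_of_lt_of_le ?_ (dist_le_pi_dist (v + z) (w + z') j)
    rw [Int.dist_eq]
    -- The corners differ by at least `L` in the coordinate `j`, the offsets `v j` and `w j` by at
    -- most `m - 1`.
    have h3 : (L : ℤ) - m + 1 ≤ |(v + z) j - (w + z') j| := by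
      simp only [Pi.add_apply]
      rw [← haz, ← hbz]
      have hab : a ≠ b := by
        rintro rfl
        exact hj (haz.symm.trans hbz)
      have hL' : (0 : ℤ) ≤ L := by positivity
      rw [le_abs]
      rcases lt_or_gt_of_ne hab with h | h
      · right
        have : (L : ℤ) ≤ (b - a) * L := le_mul_of_one_le_left hL' (by omega)
        nlinarith
      · left
        have : (L : ℤ) ≤ (a - b) * L := le_mul_of_one_le_left hL' (by omega)
        nlinarith
    have h4 : ((L : ℝ) - m + 1) ≤ |(((v + z) j : ℤ) : ℝ) - (((w + z') j : ℤ) : ℝ)| := by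
      exact_mod_cast h3
    linarith

/-- If `g(m)/m` and `c(m)/|Λ(m)|` tend to `0`, there are layouts with a negligible rest. -/
theorem eventually_exists_layout (hd : 0 < d) {g c : ℕ+ → ℝ} (hg : ∀ m, 0 ≤ g m)
    (hgm : Tendsto (fun m : ℕ+ => g m / ((m : ℕ) : ℝ)) atTop (𝓝 0))
    (hcm : Tendsto (fun m : ℕ+ => c m / ((cube d m).sites.card : ℝ)) atTop (𝓝 0))
    {ε : ℝ} (hε : 0 < ε) :
    ∀ᶠ m : ℕ+ in atTop, ∀ᶠ n : ℕ+ in atTop, ∃ J : Finset (Fin d → ℤ), IsLayout (g m) m n J ∧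
      (restSites m n J).card ≤ ε * vol d n ∧ 1 ≤ ε * J.card ∧ c m * J.card ≤ ε * vol d n := by
  -- `δ` is the proportion that may be lost in each of the `d` directions for a loss of volume of at
  -- most `ε`.
  obtain ⟨δ, hδ0, hδ1, hδ⟩ : ∃ δ : ℝ, 0 < δ ∧ δ ≤ 1 ∧ 1 - ε ≤ (1 - δ) ^ d := by
    have h1 : Tendsto (fun δ : ℝ => (1 - δ) ^ d) (𝓝[>] 0) (𝓝 ((1 - 0) ^ d)) :=
      ((continuous_const.sub continuous_id).pow d).continuousAt.tendsto.mono_left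
        nhdsWithin_le_nhds
    have h2 := h1.eventually_const_lt (u := 1 - ε) (by simp [hε])
    obtain ⟨δ, h3, h4⟩ := (h2.and (Ioc_mem_nhdsGT (zero_lt_one' ℝ))).exists
    exact ⟨δ, h4.1, h4.2, h3.le⟩
  have hinv : Tendsto (fun m : ℕ+ => (1 : ℝ) / ((m : ℕ) : ℝ)) atTop (𝓝 0) :=
    tendsto_const_nhds.div_atTop tendsto_coe_pnat
  have hsum : Tendsto (fun m : ℕ+ => g m / ((m : ℕ) : ℝ) + 1 / ((m : ℕ) : ℝ)) atTop (𝓝 0) := by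
    simpa using hgm.add hinv
  filter_upwards [hsum.eventually_lt_const (half_pos hδ0), hcm.eventually_lt_const hε]
    with m hm1 hm2
  have hm0 : (0 : ℝ) < ((m : ℕ) : ℝ) := by exact_mod_cast m.pos
  -- Half of `δ` pays for the gaps, since `L ≤ m (1 + δ/2)`; the other half pays for the incomplete
  -- last period of `[0, n[`.
  set L : ℕ := m + ⌈g m⌉₊ with hLdef
  have hLm : (m : ℕ) ≤ L := Nat.le_add_right _ _
  have hL0 : 0 < L := m.pos.trans_le hLm
  have hLr : (0 : ℝ) < L := by exact_mod_cast hL0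
  have hLg : g m < L - m + 1 := by
    have := Nat.le_ceil (g m)
    rw [hLdef]
    push_cast
    linarith
  have hLup : (L : ℝ) ≤ m * (1 + δ / 2) := by
    have h1 := Nat.ceil_lt_add_one (hg m)
    have h2 : g m + 1 < δ / 2 * m := by
      rw [← add_div, div_lt_iff₀ hm0] at hm1
      exact hm1
    rw [hLdef]
    push_cast
    linarith
  -- The first threshold makes one period at most the proportion `δ/2` of `n`; the second makes the
  -- number of blocks exceed `1/ε`.
  filter_upwards [tendsto_coe_pnat.eventually_ge_atTop (2 * L / δ),
    tendsto_coe_pnat.eventually_ge_atTop (L * (1 / ε + 1))] with n hn1 hn2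
  obtain ⟨J, hJ, hcard⟩ := exists_isLayout (d := d) m n hLm hLg
  set q : ℕ := n / L with hq
  have hqlow : ((n : ℕ) : ℝ) < (q + 1) * L := by
    have : (n : ℕ) < (q + 1) * L := by
      rw [hq, Nat.add_mul, one_mul]
      exact Nat.lt_div_mul_add hL0
    exact_mod_cast this
  have hqup : (q : ℝ) * L ≤ ((n : ℕ) : ℝ) := by exact_mod_cast Nat.div_mul_le_self _ _
  have hn0 : (0 : ℝ) < ((n : ℕ) : ℝ) := by exact_mod_cast n.pos
  have hvol := hJ.vol_eq (hg m)
  have hJr : (J.card : ℝ) = (q : ℝ) ^ d := by exact_mod_cast hcard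
  have hqm : (1 - δ) * n ≤ q * m := by
    have h1 : (n : ℝ) * δ ≥ 2 * L := by
      have := (div_le_iff₀ hδ0).1 hn1
      linarith
    have h3 : (1 - δ / 2) * n ≤ q * L := by nlinarith
    have h4 : (q : ℝ) * L ≤ q * m * (1 + δ / 2) := by
      calc (q : ℝ) * L ≤ q * (m * (1 + δ / 2)) := by gcongr
        _ = _ := by ring
    have h5 : (1 - δ) * (1 + δ / 2) ≤ 1 - δ / 2 := by nlinarith
    have h6 : (1 - δ) * n * (1 + δ / 2) ≤ q * m * (1 + δ / 2) := by
      calc (1 - δ) * n * (1 + δ / 2) = (1 - δ) * (1 + δ / 2) * n := by ring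
        _ ≤ (1 - δ / 2) * n := by gcongr
        _ ≤ _ := h3.trans h4
    exact le_of_mul_le_mul_right h6 (by positivity)
  have hrest : ((restSites m n J).card : ℝ) ≤ ε * vol d n := by
    have h1 : (1 - ε) * vol d n ≤ J.card * vol d m := by
      rw [hJr, vol_eq, vol_eq, ← mul_pow]
      calc (1 - ε) * (n : ℝ) ^ d ≤ (1 - δ) ^ d * (n : ℝ) ^ d := by gcongr
        _ = ((1 - δ) * n) ^ d := by rw [mul_pow]
        _ ≤ _ := by
          refine pow_le_pow_left₀ (mul_nonneg (by linarith) hn0.le) hqm d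
    nlinarith
  refine ⟨J, hJ, hrest, ?_, ?_⟩
  · have h1 : 1 / ε + 1 < q + 1 := by
      have : L * (1 / ε + 1) < L * (q + 1 : ℝ) := by linarith
      exact lt_of_mul_lt_mul_left this hLr.le
    have h2 : 1 / ε < q := by linarith
    have hq1 : (1 : ℝ) ≤ q := by
      have : (0 : ℝ) < q := lt_trans (by positivity) h2
      have : 0 < q := by exact_mod_cast this
      exact_mod_cast this
    have h3 : (q : ℝ) ≤ q ^ d := le_self_pow₀ hq1 hd.ne'
    rw [hJr]
    have := (div_lt_iff₀ hε).1 h2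
    nlinarith
  · have h1 : c m ≤ ε * vol d m := ((div_lt_iff₀ (vol_pos m)).1 hm2).le
    have h2 : (0 : ℝ) ≤ (restSites m n J).card := by positivity
    calc c m * J.card ≤ ε * vol d m * J.card := by gcongr
      _ ≤ _ := by nlinarith

end Layout

/-! ### The main estimate -/

section MainEstimate

variable {d : ℕ} {X : Type*} [AddCommGroup X] [Module ℝ X] [MeasurableSpace X]
  {μ : BoxMeasures d X}

/-- Decoupling along a layout. -/
theorem IsLayout.lintegral_prod_le (hμ : IsCompatibleInvariant μ) {m n : ℕ+} {g c : ℝ}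
    (hdec : ∀ S : Finset (Fin d → ℤ),
      (∀ z ∈ S, ∀ w ∈ (cube d m).sites, g < dist z w) →
      ∀ A B, MeasurableSet[siteSigma X (cube d m).sites] A → MeasurableSet[siteSigma X S] B →
        ∀ Λ : Box d, (cube d m).sites ⊆ Λ.sites → S ⊆ Λ.sites →
          ENNReal.ofReal (Real.exp (-c)) * μ Λ A * μ Λ B ≤ μ Λ (A ∩ B))
    {J : Finset (Fin d → ℤ)} (hJ : IsLayout g m n J) {F : (Fin d → ℤ) → Config d X → ℝ≥0∞}
    (hF : ∀ z, Measurable[siteSigma X (cube d m).sites] (F z)) :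
    ENNReal.ofReal (Real.exp (-c)) ^ J.card * ∏ z ∈ J, ∫⁻ σ, F z σ ∂(μ (cube d m)) ≤
      ∫⁻ σ, ∏ z ∈ J, F z (shift z σ) ∂(μ (cube d n)) := by
  have := hμ.isProbabilityMeasure (cube d n)
  suffices h : ∀ T ⊆ J, ENNReal.ofReal (Real.exp (-c)) ^ T.card *
      ∏ z ∈ T, ∫⁻ σ, F z σ ∂(μ (cube d m)) ≤
      ∫⁻ σ, ∏ z ∈ T, F z (shift z σ) ∂(μ (cube d n)) from h J subset_rfl
  intro T
  induction T using Finset.induction_on with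
  | empty => simp
  | insert z T hz ih =>
    intro hT
    rw [Finset.insert_subset_iff] at hT
    simp only [Finset.prod_insert hz, Finset.card_insert_of_notMem hz]
    -- `S` collects the blocks already treated; the new block is far from all of them at once, so a
    -- single decoupling handles it.
    set S := T.biUnion fun z => ((cube d m).translate z).sites with hS
    have hSmem : ∀ v ∈ S, ∃ z' ∈ T, ∃ w ∈ (cube d m).sites, v = w + z' := by
      intro v hv
      obtain ⟨z', hz', hv⟩ := Finset.mem_biUnion.1 hv
      exact ⟨z', hz', v - z', Box.mem_sites_translate.1 hv, by simp⟩
    have hG : Measurable[siteSigma X S] fun σ => ∏ z ∈ T, F z (shift z σ) := by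
      refine Finset.measurable_fun_prod _ fun z' hz' => (hF z').comp (measurable_shift ?_)
      intro v hv
      exact Finset.mem_biUnion.2 ⟨z', hz', Box.mem_sites_translate.2 (by simpa using hv)⟩
    have key := hμ.decoupled_lintegral (Λ := cube d n) (S := S) (z := z) hdec
      (fun v hv => by
        obtain ⟨z', hz', w, hw, rfl⟩ := hSmem v hv
        exact hJ.mem z' (hT.2 hz') w hw)
      (hJ.mem z hT.1)
      (fun v hv w hw => by
        obtain ⟨z', hz', u, hu, rfl⟩ := hSmem v hv
        exact hJ.far z' (hT.2 hz') z hT.1 (fun h => hz (h ▸ hz')) u hu w hw) (hF z) hG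
    refine le_trans ?_ key
    calc _ = ENNReal.ofReal (Real.exp (-c)) * (∫⁻ σ, F z σ ∂(μ (cube d m))) *
        (ENNReal.ofReal (Real.exp (-c)) ^ T.card *
          ∏ z ∈ T, ∫⁻ σ, F z σ ∂(μ (cube d m))) := by ring
      _ ≤ _ := by gcongr; exact ih hT.2

/-- Local lower bounds at finitely many sites. -/
theorem LocalLowerBound.lintegral_prod_le (hμ : IsCompatibleInvariant μ) {Q : Set X} {α : ℝ≥0∞}
    (hQ : MeasurableSet Q) (h : LocalLowerBound μ Q α) {Λ : Box d} {S : Finset (Fin d → ℤ)}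
    (hS : S ⊆ Λ.sites) {G : Config d X → ℝ≥0∞} (hG : Measurable[siteSigma X (Λ.sites \ S)] G) :
    α ^ S.card * ∫⁻ σ, G σ ∂(μ Λ) ≤ ∫⁻ σ, G σ * ∏ v ∈ S, Q.indicator 1 (σ v) ∂(μ Λ) := by
  suffices H : ∀ T ⊆ S, α ^ T.card * ∫⁻ σ, G σ ∂(μ Λ) ≤
      ∫⁻ σ, G σ * ∏ v ∈ T, Q.indicator 1 (σ v) ∂(μ Λ) from H S subset_rfl
  intro T
  induction T using Finset.induction_on with
  | empty => simp
  | insert z T hz ih =>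
    intro hT
    rw [Finset.insert_subset_iff] at hT
    simp only [Finset.prod_insert hz, Finset.card_insert_of_notMem hz]
    -- The integrand built so far does not see the site `z`, which is what permits conditioning site
    -- by site.
    have hmeas : Measurable[siteSigma X (Λ.sites.erase z)]
        fun σ => G σ * ∏ v ∈ T, Q.indicator (1 : X → ℝ≥0∞) (σ v) := by
      refine (hG.mono (siteSigma_mono fun v hv => ?_) le_rfl).mul
        (Finset.measurable_fun_prod _ fun v hv => ?_)
      · rw [Finset.mem_sdiff] at hv
        exact Finset.mem_erase.2 ⟨fun e => hv.2 (e ▸ hT.1), hv.1⟩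
      · exact (measurable_one.indicator hQ).comp (measurable_eval_site
          (Finset.mem_erase.2 ⟨fun e => hz (e ▸ hv), hS (hT.2 hv)⟩))
    calc α ^ (T.card + 1) * ∫⁻ σ, G σ ∂(μ Λ) = α * (α ^ T.card * ∫⁻ σ, G σ ∂(μ Λ)) := by ring
      _ ≤ α * ∫⁻ σ, G σ * ∏ v ∈ T, Q.indicator 1 (σ v) ∂(μ Λ) := by gcongr; exact ih hT.2
      _ ≤ _ := h.const_mul_lintegral_le hμ hQ (hS hT.1) hmeas
      _ = _ := lintegral_congr fun σ => by ring

/-- Independent-like lower bound for products of functions of separated blocks, when the remaining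
sites are constrained to a set of locally positive probability. -/
theorem eventually_layout_lintegral_le (hd : 0 < d) (hμ : IsCompatibleInvariant μ)
    (hdec : LowerDecoupled μ) {ε : ℝ} (hε : 0 < ε) :
    ∀ᶠ m : ℕ+ in atTop, ∀ᶠ n : ℕ+ in atTop, ∃ (J : Finset (Fin d → ℤ)) (g : ℝ), 0 ≤ g ∧
      IsLayout g m n J ∧ (restSites m n J).card ≤ ε * vol d n ∧ 1 ≤ ε * J.card ∧
      ∀ (Q : Set X) (κ : ℝ), MeasurableSet Q → 0 ≤ κ →
        LocalLowerBound μ Q (ENNReal.ofReal (Real.exp (-κ))) →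
        ∀ F : (Fin d → ℤ) → Config d X → ℝ≥0∞,
          (∀ z, Measurable[siteSigma X (cube d m).sites] (F z)) →
          expVol d (-(ε * (1 + κ))) n * ∏ z ∈ J, ∫⁻ σ, F z σ ∂(μ (cube d m)) ≤
            ∫⁻ σ, (∏ z ∈ J, F z (shift z σ)) *
              ∏ v ∈ restSites m n J, Q.indicator 1 (σ v) ∂(μ (cube d n)) := by
  obtain ⟨g, c, hg, hc, hgm, hcm, H⟩ := hdec
  filter_upwards [eventually_exists_layout hd hg hgm hcm hε] with m hm
  filter_upwards [hm] with n hn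
  obtain ⟨J, hJ, hR, hJcard, hcJ⟩ := hn
  refine ⟨J, g m, hg m, hJ, hR, hJcard, fun Q κ hQ hκ hloc F hF => ?_⟩
  have h1 := hJ.lintegral_prod_le hμ (H m) hF
  have hG : Measurable[siteSigma X ((cube d n).sites \ restSites m n J)]
      fun σ => ∏ z ∈ J, F z (shift z σ) := by
    refine Finset.measurable_fun_prod _ fun z hz => (hF z).comp (measurable_shift ?_)
    intro v hv
    rw [restSites, Finset.mem_sdiff, Finset.mem_sdiff]
    refine ⟨hJ.mem z hz v hv, fun h => h.2 (Finset.mem_biUnion.2 ⟨z, hz, ?_⟩)⟩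
    exact Box.mem_sites_translate.2 (by simpa using hv)
  have h2 := hloc.lintegral_prod_le hμ hQ (Λ := cube d n) (S := restSites m n J)
    Finset.sdiff_subset hG
  refine le_trans ?_ h2
  -- In the factor `1 + κ`, the `1` pays for the decoupling of all blocks and `κ` for the leftover
  -- sites.
  have h3 : expVol d (-(ε * (1 + κ))) n ≤
      ENNReal.ofReal (Real.exp (-κ)) ^ (restSites m n J).card *
        ENNReal.ofReal (Real.exp (-c m)) ^ J.card := by
    rw [← ENNReal.ofReal_pow (Real.exp_pos _).le, ← ENNReal.ofReal_pow (Real.exp_pos _).le,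
      ← ENNReal.ofReal_mul (by positivity), ← Real.exp_nat_mul, ← Real.exp_nat_mul,
      ← Real.exp_add]
    refine ENNReal.ofReal_le_ofReal (Real.exp_le_exp.2 ?_)
    nlinarith
  calc _ ≤ ENNReal.ofReal (Real.exp (-κ)) ^ (restSites m n J).card *
        ENNReal.ofReal (Real.exp (-c m)) ^ J.card *
        ∏ z ∈ J, ∫⁻ σ, F z σ ∂(μ (cube d m)) := by gcongr
    _ = ENNReal.ofReal (Real.exp (-κ)) ^ (restSites m n J).card *
        (ENNReal.ofReal (Real.exp (-c m)) ^ J.card *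
        ∏ z ∈ J, ∫⁻ σ, F z σ ∂(μ (cube d m))) := by ring
    _ ≤ _ := by gcongr

end MainEstimate

/-! ### Internal convex sets and seminorms -/

section Seminorms

variable {X : Type*} [AddCommGroup X] [Module ℝ X]

theorem extGauge_lt_one_iff {C : Set X} {x : X} :
    extGauge C x < 1 ↔ ∃ t : ℝ, 0 ≤ t ∧ t < 1 ∧ x ∈ t • C := by
  simp only [extGauge, iInf_lt_iff]
  constructor
  · rintro ⟨t, ht, h1⟩
    exact ⟨t, t.2, by exact_mod_cast h1, ht⟩
  · rintro ⟨t, h0, h1, ht⟩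
    exact ⟨⟨t, h0⟩, ht, ENNReal.coe_lt_one_iff.2 h1⟩

/-- A symmetric internal convex set is the open unit ball of a seminorm. -/
theorem IsInternalConvex.exists_seminorm {C : Set X} (hC : IsInternalConvex C) (hs : -C = C) :
    ∃ q : Seminorm ℝ X, C = q.ball 0 1 := by
  have hmem : ∀ x, x ∈ C ↔ ∃ t : ℝ, 0 ≤ t ∧ t < 1 ∧ x ∈ t • C := fun x => by
    rw [← extGauge_lt_one_iff]
    exact Set.ext_iff.1 hC.eq_gauge_lt_one x
  have hfin : ∀ x, ∃ t : ℝ, 0 ≤ t ∧ x ∈ t • C := fun x => by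
    have h := hC.gauge_finite x
    simp only [extGauge, iInf_lt_iff] at h
    obtain ⟨t, ht, -⟩ := h
    exact ⟨t, t.2, ht⟩
  have h0 : (0 : X) ∈ C := by
    obtain ⟨t, -, y, hy, -⟩ := hfin 0
    exact (hmem 0).2 ⟨0, le_rfl, one_pos, y, hy, by simp⟩
  have hbal : Balanced ℝ C := by
    rintro a ha - ⟨x, hx, rfl⟩
    have hnx : -x ∈ C := by rw [← hs]; simpa using hx
    rw [Real.norm_eq_abs, abs_le] at ha
    have := hC.convex hx hnx (a := (1 + a) / 2) (b := (1 - a) / 2) (by linarith) (by linarith)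
      (by ring)
    have h2 : ((1 + a) / 2) • x + ((1 - a) / 2) • (-x) = a • x := by
      rw [smul_neg, ← sub_eq_add_neg, ← sub_smul]
      congr 1
      ring
    rwa [h2] at this
  have habs : Absorbent ℝ C := by
    refine fun x => Absorbs.of_norm ?_
    obtain ⟨t, ht, y, hy, rfl⟩ := hfin x
    refine ⟨max t 1, fun c hc => Set.singleton_subset_iff.2 ?_⟩
    have hc1 : 1 ≤ ‖c‖ := (le_max_right _ _).trans hc
    have hc0 : c ≠ 0 := norm_pos_iff.1 (by linarith)
    refine ⟨(c⁻¹ * t) • y, hbal.smul_mem ?_ hy, by simp [smul_smul, hc0]⟩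
    rw [norm_mul, norm_inv, Real.norm_of_nonneg ht, inv_mul_le_iff₀ (by linarith), mul_one]
    exact (le_max_left _ _).trans hc
  refine ⟨gaugeSeminorm hbal hC.convex habs, ?_⟩
  ext x
  rw [Seminorm.mem_ball_zero]
  change _ ↔ gauge C x < 1
  constructor
  · intro hx
    obtain ⟨t, ht0, ht1, y, hy, rfl⟩ := (hmem x).1 hx
    change gauge C (t • y) < 1
    rw [gauge_smul_of_nonneg ht0, smul_eq_mul]
    exact lt_of_le_of_lt (mul_le_of_le_one_right ht0 (gauge_le_one_of_mem hy)) ht1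
  · intro hx
    obtain ⟨t, ht0, ht1, hxt⟩ := exists_lt_of_gauge_lt habs hx
    exact (hmem x).2 ⟨t, ht0.le, ht1, hxt⟩

theorem smul_ball_zero_one (q : Seminorm ℝ X) {r : ℝ} (hr : r ≠ 0) :
    r • q.ball 0 1 = q.ball 0 |r| := by
  rw [Seminorm.smul_ball_zero hr]
  simp

theorem vadd_ball_zero (q : Seminorm ℝ X) (x : X) (r : ℝ) : x +ᵥ q.ball 0 r = q.ball x r := by
  rw [Seminorm.vadd_ball, vadd_eq_add, add_zero]

theorem StableSigma.measurableSet_ball [MeasurableSpace X] (hX : StableSigma X) {q : Seminorm ℝ X}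
    (hq : MeasurableSet (q.ball 0 1)) (x : X) {r : ℝ} (hr : 0 < r) :
    MeasurableSet (q.ball x r) := by
  have := hX.vadd x _ (hX.smul r _ hr.ne' hq)
  rwa [smul_ball_zero_one q hr.ne', abs_of_pos hr, vadd_ball_zero] at this

end Seminorms

/-! ### Convexity estimates for the Cramér sequence -/

section Cramer

variable {d : ℕ} {X : Type*} [AddCommGroup X] [Module ℝ X]

theorem vol_smul_blockMean (n : ℕ+) (σ : Config d X) :
    vol d n • blockMean (cube d n) σ = ∑ v ∈ (cube d n).sites, σ v := by
  rw [blockMean, smul_smul]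
  change (vol d n * (vol d n)⁻¹) • _ = _
  rw [mul_inv_cancel₀ (vol_pos n).ne', one_smul]

theorem IsLayout.vol_smul_blockMean {g : ℝ} (hg : 0 ≤ g) {m n : ℕ+} {J : Finset (Fin d → ℤ)}
    (hJ : IsLayout g m n J) (σ : Config d X) :
    vol d n • blockMean (cube d n) σ =
      ∑ z ∈ J, vol d m • blockMean (cube d m) (shift z σ) + ∑ v ∈ restSites m n J, σ v := by
  rw [CramerField.vol_smul_blockMean, hJ.sum_eq hg]
  simp only [CramerField.vol_smul_blockMean]
  rfl

end Cramer

/-! ### Counting and seminorm estimates along a layout. -/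

section Counting

variable {d : ℕ} {X : Type*} [AddCommGroup X] [Module ℝ X]

/-- Taking logarithms, replacing the volumes of the two groups of blocks by `t * vol d n` and `(1 -
t) * vol d n` costs at most `2ε(|r| + |r'|)` per site; the layout costs `ε(1 + κ)`. -/
theorem expVol_le_mul_pow {m n : ℕ+} {k₁ k₂ : ℕ} {t r r' ε κ η : ℝ}
    (h₁ : |k₁ * vol d m - t * vol d n| ≤ 2 * ε * vol d n)
    (h₂ : |k₂ * vol d m - (1 - t) * vol d n| ≤ 2 * ε * vol d n)
    (hη : ε * (1 + κ) + 2 * ε * (|r| + |r'|) ≤ η) :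
    expVol d (t * r + (1 - t) * r' - η) n ≤
      expVol d (-(ε * (1 + κ))) n * (expVol d r' m ^ k₂ * expVol d r m ^ k₁) := by
  have hvn := vol_pos (d := d) n
  simp only [expVol]
  rw [← ENNReal.ofReal_pow (Real.exp_pos _).le, ← ENNReal.ofReal_pow (Real.exp_pos _).le,
    ← ENNReal.ofReal_mul (by positivity), ← ENNReal.ofReal_mul (by positivity),
    ← Real.exp_nat_mul, ← Real.exp_nat_mul, ← Real.exp_add, ← Real.exp_add]
  refine ENNReal.ofReal_le_ofReal (Real.exp_le_exp.2 ?_)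
  have e1 : |r * (k₁ * vol d m - t * vol d n)| ≤ |r| * (2 * ε * vol d n) := by
    rw [abs_mul]; gcongr
  have e2 : |r' * (k₂ * vol d m - (1 - t) * vol d n)| ≤ |r'| * (2 * ε * vol d n) := by
    rw [abs_mul]; gcongr
  have e3 := (abs_le.1 e1).1
  have e4 := (abs_le.1 e2).1
  have e5 : (ε * (1 + κ) + 2 * ε * (|r| + |r'|)) * vol d n ≤ η * vol d n := by gcongr
  linarith

/-- After multiplication by `vol d n`, the deviation splits into the deviations inside the blocks,
the leftover sites and the miscounts of the two groups. The blocks occupy at most `vol d n`, so they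
contribute at most 1 to the radius; by `hε` the other two terms contribute less than 1 together. -/
theorem IsLayout.seminorm_blockMean_lt {g : ℝ} (hg : 0 ≤ g) {m n : ℕ+}
    {J J₁ : Finset (Fin d → ℤ)} (hJ : IsLayout g m n J) (q : Seminorm ℝ X) (hJ₁ : J₁ ⊆ J)
    {ε t T : ℝ} (hR : (restSites m n J).card ≤ ε * vol d n)
    (h₁ : |J₁.card * vol d m - t * vol d n| ≤ 2 * ε * vol d n)
    (h₂ : |((J \ J₁).card : ℝ) * vol d m - (1 - t) * vol d n| ≤ 2 * ε * vol d n) (hT : 0 ≤ T)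
    {x x' : X} {σ : Config d X}
    (hx : ∀ z ∈ J₁, q (blockMean (cube d m) (shift z σ) - x) ≤ 1)
    (hx' : ∀ z ∈ J \ J₁, q (blockMean (cube d m) (shift z σ) - x') ≤ 1)
    (hσ : ∀ v ∈ restSites m n J, q (σ v) ≤ T)
    (hε : ε * (2 * (q x + q x') + T) < 1) :
    q (blockMean (cube d n) σ - (t • x + (1 - t) • x')) < 2 := by
  have hvm := vol_pos (d := d) m
  have hvn := vol_pos (d := d) n
  have hblock : ∀ (I : Finset (Fin d → ℤ)) (y : X),
      (∀ z ∈ I, q (blockMean (cube d m) (shift z σ) - y) ≤ 1) →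
      q (∑ z ∈ I, vol d m • (blockMean (cube d m) (shift z σ) - y)) ≤ I.card * vol d m := by
    intro I y hI
    refine (Finset.le_sum_of_subadditive q (map_zero q).le (map_add_le_add q) _ _).trans ?_
    rw [← nsmul_eq_mul]
    refine Finset.sum_le_card_nsmul _ _ _ fun z hz => ?_
    rw [map_smul_eq_mul, Real.norm_of_nonneg hvm.le]
    exact mul_le_of_le_one_right hvm.le (hI z hz)
  have hsum : ∀ (I : Finset (Fin d → ℤ)) (y : X),
      ∑ z ∈ I, vol d m • blockMean (cube d m) (shift z σ) =
        ∑ z ∈ I, vol d m • (blockMean (cube d m) (shift z σ) - y) + (I.card * vol d m) • y := by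
    intro I y
    simp only [smul_sub, Finset.sum_sub_distrib, Finset.sum_const, ← Nat.cast_smul_eq_nsmul ℝ,
      smul_smul]
    abel
  have hdecomp : vol d n • (blockMean (cube d n) σ - (t • x + (1 - t) • x')) =
      ∑ z ∈ J \ J₁, vol d m • (blockMean (cube d m) (shift z σ) - x') +
      ∑ z ∈ J₁, vol d m • (blockMean (cube d m) (shift z σ) - x) +
      ∑ v ∈ restSites m n J, σ v + ((J₁.card * vol d m - t * vol d n) • x +
        (((J \ J₁).card : ℝ) * vol d m - (1 - t) * vol d n) • x') := by
    rw [smul_sub, hJ.vol_smul_blockMean hg, ← Finset.sum_sdiff hJ₁, hsum (J \ J₁) x', hsum J₁ x]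
    simp only [sub_smul _ (t * vol d n), sub_smul _ ((1 - t) * vol d n), smul_add, smul_smul,
      mul_comm (vol d n)]
    abel
  have hq2 : q (∑ v ∈ restSites m n J, σ v) ≤ (restSites m n J).card * T := by
    refine (Finset.le_sum_of_subadditive q (map_zero q).le (map_add_le_add q) _ _).trans ?_
    rw [← nsmul_eq_mul]
    exact Finset.sum_le_card_nsmul _ _ _ hσ
  have hq3 : q ((J₁.card * vol d m - t * vol d n) • x +
      (((J \ J₁).card : ℝ) * vol d m - (1 - t) * vol d n) • x') ≤
        2 * ε * vol d n * (q x + q x') := by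
    refine (map_add_le_add q _ _).trans ?_
    rw [map_smul_eq_mul, map_smul_eq_mul, Real.norm_eq_abs, Real.norm_eq_abs, mul_add]
    have := apply_nonneg q x
    have := apply_nonneg q x'
    gcongr
  have hq4 : vol d n * q (blockMean (cube d n) σ - (t • x + (1 - t) • x')) ≤
      ((J \ J₁).card : ℝ) * vol d m + J₁.card * vol d m + (restSites m n J).card * T +
        2 * ε * vol d n * (q x + q x') := by
    have h1 := map_smul_eq_mul q (vol d n) (blockMean (cube d n) σ - (t • x + (1 - t) • x'))
    rw [Real.norm_of_nonneg hvn.le] at h1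
    rw [← h1, hdecomp]
    refine (map_add_le_add q _ _).trans (add_le_add ((map_add_le_add q _ _).trans
      (add_le_add ((map_add_le_add q _ _).trans (add_le_add ?_ ?_)) hq2)) hq3)
    · exact hblock _ _ hx'
    · exact hblock _ _ hx
  have hcard : ((J \ J₁).card : ℝ) + J₁.card = J.card := by
    exact_mod_cast Finset.card_sdiff_add_card_eq_card hJ₁
  have hvol := hJ.vol_eq hg
  have hR0 : (0 : ℝ) ≤ (restSites m n J).card := by positivity
  have hq5 : ((restSites m n J).card : ℝ) * T ≤ ε * vol d n * T := by gcongr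
  have e6 : ε * (2 * (q x + q x') + T) * vol d n < 1 * vol d n := by gcongr
  have hq6 : ((J \ J₁).card : ℝ) * vol d m + J₁.card * vol d m ≤ vol d n := by
    rw [← add_mul, hcard]
    linarith
  have e7 : vol d n * q (blockMean (cube d n) σ - (t • x + (1 - t) • x')) < vol d n * 2 := by
    linarith
  exact lt_of_mul_lt_mul_left e7 hvn.le

end Counting

/-! ### Exponential lower bounds for the Cramér sequence. -/

section Cramer

variable {d : ℕ} {X : Type*} [AddCommGroup X] [Module ℝ X] [MeasurableSpace X]
  {μ : BoxMeasures d X}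

theorem cramerSeq_apply (μ : BoxMeasures d X) (n : ℕ+) {A : Set X} (hA : MeasurableSet A) :
    cramerSeq μ n A = μ (cube d n) (blockMean (cube d n) ⁻¹' A) :=
  @Measure.map_apply _ _ (siteSigma X (cube d n).sites) _ _ _
    (measurable_blockMean subset_rfl) _ hA

theorem lintegral_cramerSeq (μ : BoxMeasures d X) (n : ℕ+) {F : X → ℝ≥0∞} (hF : Measurable F) :
    ∫⁻ x, F x ∂(cramerSeq μ n) = ∫⁻ σ, F (blockMean (cube d n) σ) ∂(μ (cube d n)) :=
  @lintegral_map _ _ (siteSigma X (cube d n).sites) _ _ _ _ hF (measurable_blockMean subset_rfl)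

theorem IsCompatibleInvariant.isProbabilityMeasure_cramerSeq (hμ : IsCompatibleInvariant μ)
    (n : ℕ+) : IsProbabilityMeasure (cramerSeq μ n) :=
  ⟨by rw [cramerSeq_apply μ n MeasurableSet.univ, Set.preimage_univ, hμ.prob]⟩

theorem LocalLowerBound.mono {Q : Set X} {α β : ℝ≥0∞} (h : LocalLowerBound μ Q α) (hβ : β ≤ α) :
    LocalLowerBound μ Q β := fun Λ h0 B hB =>
  (mul_le_mul_left hβ _).trans (h Λ h0 B hB)

/-- Local control, with an exponential lower bound. -/
theorem LocallyControlled.exists_bound (hX : StableSigma X) (hμ : IsCompatibleInvariant μ)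
    (h : LocallyControlled μ) {q : Seminorm ℝ X} (hq : q.ball 0 1 ∈ measurableInternal X) :
    ∃ t κ : ℝ, 0 < t ∧ 0 ≤ κ ∧ MeasurableSet (q.ball 0 t) ∧
      LocalLowerBound μ (q.ball 0 t) (ENNReal.ofReal (Real.exp (-κ))) := by
  obtain ⟨t, α, ht, hα, H⟩ := h
  have hm := hX.measurableSet_ball hq.2 0 (ht ⟨_, hq⟩)
  refine ⟨t ⟨_, hq⟩, max 0 (-Real.log (α ⟨_, hq⟩)), ht _, le_max_left _ _, hm, ?_⟩
  refine LocalLowerBound.mono (α := ENNReal.ofReal (α ⟨_, hq⟩)) ?_ ?_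
  · refine hμ.localLowerBound hm fun Λ h0 => ?_
    have := H ⟨_, hq⟩ Λ h0
    rwa [smul_ball_zero_one q (ht _).ne', abs_of_pos (ht _)] at this
  · refine ENNReal.ofReal_le_ofReal ?_
    rw [← Real.le_log_iff_exp_le (hα _)]
    linarith [le_max_right 0 (-Real.log (α ⟨_, hq⟩))]

/-- If `ν_m` charges enough two balls of the same seminorm, then `ν_n`, for `n` large, charges
enough the ball of double radius centred at a given convex combination of the centres. -/
theorem eventually_le_cramerSeq_ball (hd : 0 < d) (hX : StableSigma X)
    (hμ : IsCompatibleInvariant μ) (hdec : LowerDecoupled μ) (hcon : LocallyControlled μ)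
    {q : Seminorm ℝ X} (hq : q.ball 0 1 ∈ measurableInternal X) (x x' : X) {t : ℝ} (ht0 : 0 ≤ t)
    (ht1 : t ≤ 1) (r r' : ℝ) {η : ℝ} (hη : 0 < η) :
    ∀ᶠ m : ℕ+ in atTop, expVol d r m ≤ cramerSeq μ m (q.ball x 1) →
      expVol d r' m ≤ cramerSeq μ m (q.ball x' 1) →
      ∀ᶠ n : ℕ+ in atTop, expVol d (t * r + (1 - t) * r' - η) n ≤
        cramerSeq μ n (q.ball (t • x + (1 - t) • x') 2) := by
  obtain ⟨T, κ, hT, hκ, hQm, hQ⟩ := hcon.exists_bound hX hμ hq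
  have hball := fun (x : X) {r : ℝ} (hr : 0 < r) => hX.measurableSet_ball hq.2 x hr
  have hqx := apply_nonneg q x
  have hqx' := apply_nonneg q x'
  -- `M` gathers all errors: `ε M ≤ η` controls the exponent and `ε M < 1` controls the radius.
  set M : ℝ := 1 + κ + 2 * (|r| + |r'|) + 2 * (q x + q x') + T with hM
  have hM0 : 0 < M := by positivity
  obtain ⟨ε, hε, hεη, hε1⟩ : ∃ ε : ℝ, 0 < ε ∧ ε * M ≤ η ∧ ε * M < 1 := by
    refine ⟨min η (1 / 2) / M, by positivity, ?_, ?_⟩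
    · rw [div_mul_cancel₀ _ hM0.ne']; exact min_le_left _ _
    · rw [div_mul_cancel₀ _ hM0.ne']
      exact lt_of_le_of_lt (min_le_right _ _) (by norm_num)
  filter_upwards [eventually_layout_lintegral_le hd hμ hdec hε] with m hm hr hr'
  filter_upwards [hm] with n hn
  obtain ⟨J, g, hg, hJ, hR, hJ1, H⟩ := hn
  have hvol := hJ.vol_eq hg
  have hR0 : (0 : ℝ) ≤ (restSites m n J).card := by positivity
  have hvm := vol_pos (d := d) m
  have hvn := vol_pos (d := d) n
  have hk0 : (0 : ℝ) ≤ J.card := by positivity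
  set k : ℝ := (J.card : ℝ) with hk
  obtain ⟨J₁, hJ₁, hJ₁c⟩ := Finset.exists_subset_card_eq (s := J) (n := ⌊t * k⌋₊) (by
    refine Nat.floor_le_of_le ?_
    rw [← hk]
    exact mul_le_of_le_one_left hk0 ht1)
  have hk1 : (J₁.card : ℝ) ≤ t * k := by rw [hJ₁c]; exact Nat.floor_le (by positivity)
  have hk1' : t * k < J₁.card + 1 := by rw [hJ₁c]; exact Nat.lt_floor_add_one _
  have hk2 : ((J \ J₁).card : ℝ) = k - J₁.card := by
    rw [Finset.card_sdiff_of_subset hJ₁, Nat.cast_sub (Finset.card_le_card hJ₁)]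
  -- Rounding `t * k` to an integer misplaces less than one block, negligible because `1 ≤ ε *
  -- J.card`. The `2ε` below is one `ε` for rounding and one for the leftover sites.
  have hvmε : vol d m ≤ ε * vol d n := by nlinarith
  have hkm : k * vol d m ≤ vol d n := by linarith
  have hkm' : vol d n - ε * vol d n ≤ k * vol d m := by linarith
  have hA1 : |J₁.card * vol d m - t * vol d n| ≤ 2 * ε * vol d n := by
    rw [abs_le]; constructor <;> nlinarith
  have hA2 : |((J \ J₁).card : ℝ) * vol d m - (1 - t) * vol d n| ≤ 2 * ε * vol d n := by
    rw [hk2, abs_le]; constructor <;> nlinarith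
  let c : (Fin d → ℤ) → X := fun z => if z ∈ J₁ then x else x'
  let F : (Fin d → ℤ) → Config d X → ℝ≥0∞ := fun z σ =>
    (q.ball (c z) 1).indicator 1 (blockMean (cube d m) σ)
  have hF : ∀ z, Measurable[siteSigma X (cube d m).sites] (F z) := fun z =>
    (measurable_one.indicator (hball _ one_pos)).comp (measurable_blockMean subset_rfl)
  have hFint : ∀ z, ∫⁻ σ, F z σ ∂(μ (cube d m)) = cramerSeq μ m (q.ball (c z) 1) := fun z => by
    rw [← lintegral_cramerSeq μ m (measurable_one.indicator (hball _ one_pos)),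
      lintegral_indicator_one (hball _ one_pos)]
  have key := H _ κ hQm hκ hQ F hF
  have hlow : expVol d (t * r + (1 - t) * r' - η) n ≤
      expVol d (-(ε * (1 + κ))) n * ∏ z ∈ J, ∫⁻ σ, F z σ ∂(μ (cube d m)) := by
    simp only [hFint]
    rw [← Finset.prod_sdiff hJ₁]
    calc expVol d (t * r + (1 - t) * r' - η) n
        ≤ expVol d (-(ε * (1 + κ))) n *
          ((expVol d r' m) ^ (J \ J₁).card * (expVol d r m) ^ J₁.card) := by
          exact expVol_le_mul_pow hA1 hA2 (by
            have : 0 ≤ ε * (2 * (q x + q x') + T) := by positivity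
            nlinarith)
      _ ≤ _ := by
          gcongr
          · refine Finset.pow_card_le_prod _ _ _ fun z hz => ?_
            simpa [c, (Finset.mem_sdiff.1 hz).2] using hr'
          · refine Finset.pow_card_le_prod _ _ _ fun z hz => ?_
            simpa [c, hz] using hr
  refine hlow.trans (key.trans ?_)
  have hb2 := hball (t • x + (1 - t) • x') two_pos
  rw [← lintegral_indicator_one hb2, lintegral_cramerSeq μ n (measurable_one.indicator hb2)]
  refine lintegral_mono fun σ => ?_
  by_cases hz1 : ∃ z ∈ J, blockMean (cube d m) (shift z σ) ∉ q.ball (c z) 1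
  · obtain ⟨z, hz, hz'⟩ := hz1
    rw [Finset.prod_eq_zero hz (by simp [F, hz']), zero_mul]
    exact zero_le
  by_cases hz2 : ∃ v ∈ restSites m n J, σ v ∉ q.ball 0 T
  · obtain ⟨v, hv, hv'⟩ := hz2
    rw [Finset.prod_eq_zero (i := v) hv (Set.indicator_of_notMem hv' _), mul_zero]
    exact zero_le
  push Not at hz1 hz2
  have hin : blockMean (cube d n) σ ∈ q.ball (t • x + (1 - t) • x') 2 := by
    rw [Seminorm.mem_ball]
    refine hJ.seminorm_blockMean_lt hg q hJ₁ hR hA1 hA2 hT.le (fun z hz => ?_)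
      (fun z hz => ?_) (fun v hv => ?_) ?_
    · have := (q.mem_ball.1 (hz1 z (hJ₁ hz))).le
      simpa only [c, hz, if_true] using this
    · have := (q.mem_ball.1 (hz1 z (Finset.mem_sdiff.1 hz).1)).le
      simpa only [c, (Finset.mem_sdiff.1 hz).2, if_false] using this
    · have := hz2 v hv
      rw [Seminorm.mem_ball, sub_zero] at this
      exact this.le
    · have : 0 ≤ ε * (1 + κ + 2 * (|r| + |r'|)) := by positivity
      nlinarith
  rw [Set.indicator_of_mem hin]
  refine mul_le_one' (Finset.prod_le_one' fun z _ => ?_) (Finset.prod_le_one' fun v _ => ?_)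
  · exact Set.indicator_le_self' (fun _ _ => zero_le) _
  · exact Set.indicator_le_self' (fun _ _ => zero_le) _

/-- The function `exp(|Λ(n)| ⟨ℓ | 𝔪_{Λ(n)}⟩)`, restricted to the event that all the sites of `Λ(n)`
have values in `K`. -/
def tilt (d : ℕ) (ℓ : X →ₗ[ℝ] ℝ) (K : Set X) (n : ℕ+) : Config d X → ℝ≥0∞ :=
  {σ | ∀ v ∈ (cube d n).sites, σ v ∈ K}.indicator
    fun σ => ENNReal.ofReal (Real.exp (vol d n * ℓ (blockMean (cube d n) σ)))

theorem measurableSet_forall_mem {K : Set X} (hK : MeasurableSet K) (n : ℕ+) :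
    MeasurableSet[siteSigma X (cube d n).sites]
      {σ : Config d X | ∀ v ∈ (cube d n).sites, σ v ∈ K} := by
  have h : {σ : Config d X | ∀ v ∈ (cube d n).sites, σ v ∈ K} =
      ⋂ v ∈ (cube d n).sites, (fun σ : Config d X => σ v) ⁻¹' K := by
    ext σ
    simp
  rw [h]
  exact Finset.measurableSet_biInter _ fun v hv => measurable_eval_site hv hK

theorem measurable_tilt {ℓ : X →ₗ[ℝ] ℝ} (hℓ : Measurable ℓ) {K : Set X} (hK : MeasurableSet K)
    (n : ℕ+) : Measurable[siteSigma X (cube d n).sites] (tilt d ℓ K n) := by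
  refine Measurable.indicator ?_ (measurableSet_forall_mem hK n)
  have h : Measurable fun x : X => ENNReal.ofReal (Real.exp (vol d n * ℓ x)) := by fun_prop
  exact h.comp (measurable_blockMean subset_rfl)

/-- Supermultiplicativity of the exponential moments restricted to a set. -/
theorem eventually_le_lintegral_tilt (hd : 0 < d) (hμ : IsCompatibleInvariant μ)
    (hdec : LowerDecoupled μ) {ℓ : X →ₗ[ℝ] ℝ} (hℓ : Measurable ℓ) {t κ : ℝ} (ht : 0 ≤ t)
    (hκ : 0 ≤ κ) (a : ℝ) {η : ℝ} (hη : 0 < η) :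
    ∀ᶠ m : ℕ+ in atTop, ∀ K Q : Set X, MeasurableSet K → MeasurableSet Q → Q ⊆ K →
      (∀ y ∈ Q, -t ≤ ℓ y) → LocalLowerBound μ Q (ENNReal.ofReal (Real.exp (-κ))) →
      expVol d a m ≤ ∫⁻ σ, tilt d ℓ K m σ ∂(μ (cube d m)) →
      ∀ᶠ n : ℕ+ in atTop, expVol d (a - η) n ≤ ∫⁻ σ, tilt d ℓ K n σ ∂(μ (cube d n)) := by
  -- On the leftover sites, `1 + κ` is the price of the layout, `t` bounds the loss on `ℓ`, and
  -- `|a|` accounts for the volume not covered by blocks.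
  set M : ℝ := 1 + κ + t + |a| with hM
  have hM0 : 0 < M := by positivity
  obtain ⟨ε, hε, hεη⟩ : ∃ ε : ℝ, 0 < ε ∧ ε * M ≤ η :=
    ⟨η / M, by positivity, by rw [div_mul_cancel₀ _ hM0.ne']⟩
  filter_upwards [eventually_layout_lintegral_le hd hμ hdec hε] with m hm K Q hK hQm hQK hQt hQ ha
  filter_upwards [hm] with n hn
  obtain ⟨J, g, hg, hJ, hR, -, H⟩ := hn
  have hvol := hJ.vol_eq hg
  have hvn := vol_pos (d := d) n
  have hR0 : (0 : ℝ) ≤ (restSites m n J).card := by positivity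
  have key := H Q κ hQm hκ hQ (fun _ => tilt d ℓ K m) fun _ => measurable_tilt hℓ hK m
  have hlow : expVol d (a - η) n ≤ expVol d (-(ε * t)) n * (expVol d (-(ε * (1 + κ))) n *
      ∏ z ∈ J, ∫⁻ σ, tilt d ℓ K m σ ∂(μ (cube d m))) := by
    calc expVol d (a - η) n ≤ expVol d (-(ε * t)) n * (expVol d (-(ε * (1 + κ))) n *
          (expVol d a m) ^ J.card) := by
          simp only [expVol]
          rw [← ENNReal.ofReal_pow (Real.exp_pos _).le,
            ← ENNReal.ofReal_mul (by positivity), ← ENNReal.ofReal_mul (by positivity),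
            ← Real.exp_nat_mul, ← Real.exp_add, ← Real.exp_add]
          refine ENNReal.ofReal_le_ofReal (Real.exp_le_exp.2 ?_)
          have e1 : a * (restSites m n J).card ≤ |a| * (ε * vol d n) := by
            calc a * (restSites m n J).card ≤ |a| * (restSites m n J).card := by
                  gcongr; exact le_abs_self a
              _ ≤ _ := by gcongr
          have e3 : ε * M * vol d n ≤ η * vol d n := by gcongr
          have e5 : ε * M * vol d n = ε * t * vol d n + ε * (1 + κ) * vol d n +
              |a| * (ε * vol d n) := by rw [hM]; ring
          have e6 : a * vol d n = J.card * (a * vol d m) + a * (restSites m n J).card := by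
            rw [hvol]; ring
          nlinarith
      _ ≤ _ := by
          gcongr
          exact Finset.pow_card_le_prod _ _ _ fun z _ => ha
  refine hlow.trans ((mul_le_mul_right key _).trans ?_)
  rw [← lintegral_const_mul' _ _ (expVol_ne_top _ _)]
  refine lintegral_mono fun σ => ?_
  by_cases hz1 : ∃ z ∈ J, ¬ ∀ v ∈ (cube d m).sites, shift z σ v ∈ K
  · obtain ⟨z, hz, hz'⟩ := hz1
    rw [Finset.prod_eq_zero (i := z) hz (Set.indicator_of_notMem
      (s := {σ : Config d X | ∀ v ∈ (cube d m).sites, σ v ∈ K}) hz' _), zero_mul, mul_zero]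
    exact zero_le
  by_cases hz2 : ∃ v ∈ restSites m n J, σ v ∉ Q
  · obtain ⟨v, hv, hv'⟩ := hz2
    rw [Finset.prod_eq_zero (i := v) hv (Set.indicator_of_notMem hv' _), mul_zero, mul_zero]
    exact zero_le
  push Not at hz1 hz2
  have hin : ∀ v ∈ (cube d n).sites, σ v ∈ K := by
    intro v hv
    by_cases hvr : v ∈ restSites m n J
    · exact hQK (hz2 v hvr)
    · rw [restSites, Finset.mem_sdiff, not_and, not_not] at hvr
      obtain ⟨z, hz, hv'⟩ := Finset.mem_biUnion.1 (hvr hv)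
      simpa [shift] using hz1 z hz _ (Box.mem_sites_translate.1 hv')
  have h1 : ∏ v ∈ restSites m n J, Q.indicator (1 : X → ℝ≥0∞) (σ v) = 1 :=
    Finset.prod_eq_one fun v hv => Set.indicator_of_mem (hz2 v hv) _
  have h2 : ∀ z ∈ J, tilt d ℓ K m (shift z σ) =
      ENNReal.ofReal (Real.exp (vol d m * ℓ (blockMean (cube d m) (shift z σ)))) := fun z hz =>
    Set.indicator_of_mem (s := {σ : Config d X | ∀ v ∈ (cube d m).sites, σ v ∈ K}) (hz1 z hz) _
  have h3 : tilt d ℓ K n σ = ENNReal.ofReal (Real.exp (vol d n * ℓ (blockMean (cube d n) σ))) :=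
    Set.indicator_of_mem (s := {σ : Config d X | ∀ v ∈ (cube d n).sites, σ v ∈ K}) hin _
  rw [h1, mul_one, Finset.prod_congr rfl h2, h3, expVol,
    ← ENNReal.ofReal_prod_of_nonneg fun _ _ => (Real.exp_pos _).le,
    ← ENNReal.ofReal_mul (Real.exp_pos _).le, ← Real.exp_sum, ← Real.exp_add]
  refine ENNReal.ofReal_le_ofReal (Real.exp_le_exp.2 ?_)
  have h4 : vol d n * ℓ (blockMean (cube d n) σ) =
      ∑ z ∈ J, vol d m * ℓ (blockMean (cube d m) (shift z σ)) +
        ∑ v ∈ restSites m n J, ℓ (σ v) := by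
    have := congrArg ℓ (hJ.vol_smul_blockMean hg σ)
    simpa [map_sum] using this
  have h5 : -(ε * t * vol d n) ≤ ∑ v ∈ restSites m n J, ℓ (σ v) := by
    have : (restSites m n J).card • (-t) ≤ ∑ v ∈ restSites m n J, ℓ (σ v) :=
      Finset.card_nsmul_le_sum _ _ _ fun v hv => hQt _ (hz2 v hv)
    rw [nsmul_eq_mul] at this
    nlinarith
  rw [h4]
  linarith

end Cramer

/-! ### Topologies generated by translates of seminorm balls -/

section SeminormBase

variable {X : Type*} [AddCommGroup X] [Module ℝ X]

/-- A downward directed family of open unit balls of seminorms, stable under dilations. -/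
structure IsSeminormBase (𝒞 : Set (Set X)) : Prop where
  nonempty : 𝒞.Nonempty
  ball : ∀ C ∈ 𝒞, ∃ q : Seminorm ℝ X, C = q.ball 0 1
  inter : ∀ C ∈ 𝒞, ∀ C' ∈ 𝒞, ∃ C'' ∈ 𝒞, C'' ⊆ C ∩ C'
  dilate : ∀ r : ℝ, r ≠ 0 → ∀ C ∈ 𝒞, r • C ∈ 𝒞

variable {𝒞 : Set (Set X)}

/-- The translates are given only as a subbase. Directedness handles intersections; a point `x` of
the ball of centre `y` is recentred by the triangle inequality, with the dilated ball of radius `1 -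
q (x - y)`. -/
theorem IsSeminormBase.mem_nhds_iff (h : IsSeminormBase 𝒞) {x : X} {U : Set X} :
    U ∈ @nhds X (familyTopology 𝒞) x ↔ ∃ C ∈ 𝒞, x +ᵥ C ⊆ U := by
  let _ := familyTopology 𝒞
  constructor
  · intro hU
    obtain ⟨V, hVU, hV, hxV⟩ := _root_.mem_nhds_iff.1 hU
    suffices H : ∃ C ∈ 𝒞, x +ᵥ C ⊆ V by
      obtain ⟨C, hC, hCV⟩ := H
      exact ⟨C, hC, hCV.trans hVU⟩
    clear hU hVU
    change TopologicalSpace.GenerateOpen _ V at hV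
    induction hV with
    | univ => exact h.nonempty.imp fun C hC => ⟨hC, Set.subset_univ _⟩
    | inter V V' _ _ ih ih' =>
      obtain ⟨C, hC, hCV⟩ := ih hxV.1
      obtain ⟨C', hC', hCV'⟩ := ih' hxV.2
      obtain ⟨C'', hC'', hsub⟩ := h.inter C hC C' hC'
      rw [Set.subset_inter_iff] at hsub
      exact ⟨C'', hC'', Set.subset_inter ((Set.vadd_set_mono hsub.1).trans hCV)
        ((Set.vadd_set_mono hsub.2).trans hCV')⟩
    | sUnion S _ ih =>
      obtain ⟨V, hV, hxV⟩ := hxV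
      obtain ⟨C, hC, hCV⟩ := ih V hV hxV
      exact ⟨C, hC, hCV.trans (Set.subset_sUnion_of_mem hV)⟩
    | basic V hV =>
      obtain ⟨y, C, hC, rfl⟩ := hV
      obtain ⟨q, rfl⟩ := h.ball C hC
      rw [vadd_ball_zero, Seminorm.mem_ball] at hxV
      refine ⟨(1 - q (x - y)) • q.ball 0 1, h.dilate _ (by linarith) _ hC, ?_⟩
      rw [smul_ball_zero_one q (by linarith), vadd_ball_zero, vadd_ball_zero,
        abs_of_pos (by linarith)]
      intro z hz
      rw [Seminorm.mem_ball] at hz ⊢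
      have := map_add_le_add q (z - x) (x - y)
      rw [sub_add_sub_cancel] at this
      linarith
  · rintro ⟨C, hC, hCU⟩
    refine Filter.mem_of_superset (IsOpen.mem_nhds ?_ ?_) hCU
    · exact TopologicalSpace.GenerateOpen.basic _ ⟨x, C, hC, rfl⟩
    · obtain ⟨q, rfl⟩ := h.ball C hC
      rw [vadd_ball_zero]
      exact Seminorm.mem_ball_self q one_pos

/-- A linear form is bounded by a seminorm if it is bounded on the unit ball. -/
theorem abs_le_seminorm {q : Seminorm ℝ X} {ℓ : X →ₗ[ℝ] ℝ}
    (h : ∀ y ∈ q.ball 0 1, |ℓ y| ≤ 1) (x : X) : |ℓ x| ≤ q x := by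
  refine le_of_forall_gt_imp_ge_of_dense fun t ht => ?_
  have ht0 : 0 < t := (apply_nonneg q x).trans_lt ht
  have h1 := h (t⁻¹ • x) (by
    rw [Seminorm.mem_ball_zero, map_smul_eq_mul, norm_inv, Real.norm_of_nonneg ht0.le,
      inv_mul_lt_iff₀ ht0, mul_one]
    exact ht)
  rw [map_smul, smul_eq_mul, abs_mul, abs_inv, abs_of_pos ht0, inv_mul_le_iff₀ ht0, mul_one] at h1
  exact h1

theorem IsSeminormBase.mem_dualOf_iff (h : IsSeminormBase 𝒞) {ℓ : X →ₗ[ℝ] ℝ} :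
    ℓ ∈ dualOf (familyTopology 𝒞) ↔ ∃ C ∈ 𝒞, ∀ y ∈ C, |ℓ y| ≤ 1 := by
  let _ := familyTopology 𝒞
  constructor
  · intro hℓ
    have hc : Continuous ℓ := hℓ
    have h1 : ℓ ⁻¹' (Metric.ball 0 1) ∈ 𝓝 (0 : X) :=
      hc.continuousAt.preimage_mem_nhds (by rw [map_zero]; exact Metric.ball_mem_nhds _ one_pos)
    obtain ⟨C, hC, hsub⟩ := h.mem_nhds_iff.1 h1
    refine ⟨C, hC, fun y hy => ?_⟩
    have := hsub (Set.vadd_mem_vadd_set hy)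
    rw [zero_vadd, Set.mem_preimage, Metric.mem_ball, Real.dist_eq, sub_zero] at this
    exact this.le
  · rintro ⟨C, hC, hb⟩
    change Continuous ℓ
    rw [continuous_iff_continuousAt]
    intro x
    rw [Metric.continuousAt_iff']
    intro ε hε
    refine h.mem_nhds_iff.2 ⟨(ε / 2) • C, h.dilate _ (by positivity) C hC, ?_⟩
    rintro - ⟨-, ⟨y, hy, rfl⟩, rfl⟩
    have := hb y hy
    simp only [Set.mem_ofPred_eq, vadd_eq_add, map_add, map_smul, smul_eq_mul, Real.dist_eq,
      add_sub_cancel_left, abs_mul, abs_of_pos (half_pos hε)]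
    nlinarith

theorem MeasurableLCS.isSeminormBase [MeasurableSpace X] (E : MeasurableLCS X) :
    IsSeminormBase E.C₀ where
  nonempty := E.nonempty
  ball C hC := (E.internal hC).1.exists_seminorm (E.symmetric C hC)
  inter C hC C' hC' := ⟨_, E.inter C hC C' hC', subset_rfl⟩
  dilate := E.dilate

end SeminormBase

/-! ### The topology of a projective limit -/

section Limit

variable {J : Type*} [Preorder J] {X : Type*} [AddCommGroup X] [Module ℝ X]
  [MeasurableSpace X] {Y : J → Type*} [∀ i, AddCommGroup (Y i)] [∀ i, Module ℝ (Y i)]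
  [∀ i, MeasurableSpace (Y i)]

theorem vadd_preimage {X Y : Type*} [AddCommGroup X] [Module ℝ X] [AddCommGroup Y] [Module ℝ Y]
    (f : X →ₗ[ℝ] Y) (x : X) (C : Set Y) : x +ᵥ f ⁻¹' C = f ⁻¹' (f x +ᵥ C) := by
  ext y
  simp only [Set.mem_preimage, Set.mem_vadd_set_iff_neg_vadd_mem, vadd_eq_add, map_add, map_neg]

theorem ProjectiveSystem.exists_subset_preimage (P : ProjectiveSystem X Y) {i j : J} (h : i ≤ j)
    {C : Set (Y i)} (hC : C ∈ (P.space i).C₀) :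
    ∃ C' ∈ (P.space j).C₀, P.f j ⁻¹' C' ⊆ P.f i ⁻¹' C := by
  let _ := (P.space i).topology
  let _ := (P.space j).topology
  have hc : Continuous (P.trans i j h) := P.trans_continuous i j h
  have h1 : P.trans i j h ⁻¹' C ∈ 𝓝 (0 : Y j) := by
    refine hc.continuousAt.preimage_mem_nhds ?_
    rw [map_zero]
    exact (P.space i).isSeminormBase.mem_nhds_iff.2 ⟨C, hC, by rw [zero_vadd]⟩
  obtain ⟨C', hC', hsub⟩ := (P.space j).isSeminormBase.mem_nhds_iff.1 h1
  refine ⟨C', hC', fun x hx => ?_⟩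
  rw [zero_vadd] at hsub
  have := hsub hx
  rwa [Set.mem_preimage, ← LinearMap.comp_apply, P.trans_f] at this

/-- Balls coming from two indices are refined at a common upper bound, by continuity of the
transition maps. This yields directedness rather than stability under intersections, whence the form
of `IsSeminormBase.inter`. -/
theorem ProjectiveSystem.isSeminormBase [Nonempty J] [IsDirectedOrder J]
    (P : ProjectiveSystem X Y) : IsSeminormBase P.limitFamily where
  nonempty := by
    obtain ⟨i⟩ := ‹Nonempty J›
    obtain ⟨C, hC⟩ := (P.space i).nonempty
    exact ⟨_, i, C, hC, rfl⟩
  ball := by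
    rintro - ⟨i, C, hC, rfl⟩
    obtain ⟨q, rfl⟩ := (P.space i).isSeminormBase.ball C hC
    refine ⟨q.comp (P.f i), ?_⟩
    ext x
    simp
  inter := by
    rintro - ⟨i, C, hC, rfl⟩ - ⟨j, C', hC', rfl⟩
    obtain ⟨k, hik, hjk⟩ := exists_ge_ge i j
    obtain ⟨A, hA, hAC⟩ := P.exists_subset_preimage hik hC
    obtain ⟨B, hB, hBC⟩ := P.exists_subset_preimage hjk hC'
    exact ⟨_, ⟨k, A ∩ B, (P.space k).inter A hA B hB, rfl⟩, fun x hx => ⟨hAC hx.1, hBC hx.2⟩⟩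
  dilate := by
    rintro r hr - ⟨i, C, hC, rfl⟩
    refine ⟨i, r • C, (P.space i).dilate r hr C hC, ?_⟩
    ext x
    rw [Set.mem_smul_set_iff_inv_smul_mem₀ hr, Set.mem_preimage, Set.mem_preimage,
      Set.mem_smul_set_iff_inv_smul_mem₀ hr, map_smul]

theorem ProjectiveSystem.measurableSet_vadd (P : ProjectiveSystem X Y) {C : Set X}
    (hC : C ∈ P.limitFamily) (x : X) : MeasurableSet (x +ᵥ C) := by
  obtain ⟨i, C, hC, rfl⟩ := hC
  exact P.stable.vadd x _ (P.f_measurable i ((P.space i).internal hC).2)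

end Limit

/-! ### Weak large deviations principles from a Ruelle–Lanford property -/

section AbstractLDP

variable {d : ℕ} {Z : Type*} [MeasurableSpace Z]

/-- The cardinality of a finite cover is invisible at the exponential scale. -/
theorem eventually_natCast_le_expVol (hd : 0 < d) (N : ℕ) {δ : ℝ} (hδ : 0 < δ) :
    ∀ᶠ n : ℕ+ in atTop, (N : ℝ≥0∞) ≤ expVol d δ n := by
  filter_upwards [(tendsto_vol hd).eventually_ge_atTop (N / δ)] with n hn
  rw [expVol, ← ENNReal.ofReal_natCast]
  refine ENNReal.ofReal_le_ofReal ?_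
  have h1 : (N : ℝ) ≤ δ * vol d n := by
    rw [mul_comm]
    exact (div_le_iff₀ hδ).1 hn
  linarith [Real.add_one_le_exp (δ * vol d n)]

theorem le_liminf_logRate {r : ℝ} {u : ℕ+ → ℝ≥0∞}
    (h : ∀ η : ℝ, 0 < η → ∀ᶠ n in atTop, expVol d (r - η) n ≤ u n) :
    (r : EReal) ≤ liminf (fun n => logRate d n (u n)) atTop := by
  refine EReal.ge_of_forall_gt_iff_ge.1 fun z hz => ?_
  have hz' : z < r := by exact_mod_cast hz
  refine le_liminf_of_le (by isBoundedDefault) ?_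
  filter_upwards [h (r - z) (by linarith)] with n hn
  rw [coe_le_logRate]
  simpa using hn

theorem limsup_logRate_le {r : ℝ} {u : ℕ+ → ℝ≥0∞}
    (h : ∀ η : ℝ, 0 < η → ∀ᶠ n in atTop, u n ≤ expVol d (r + η) n) :
    limsup (fun n => logRate d n (u n)) atTop ≤ (r : EReal) := by
  refine EReal.le_of_forall_lt_iff_le.1 fun z hz => ?_
  have hz' : r < z := by exact_mod_cast hz
  refine limsup_le_of_le (by isBoundedDefault) ?_
  filter_upwards [h (z - r) (by linarith)] with n hn
  rw [logRate_le_coe]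
  simpa using hn

theorem eventually_le_expVol_of_limsup_lt {r : ℝ} {u : ℕ+ → ℝ≥0∞}
    (h : limsup (fun n => logRate d n (u n)) atTop < (r : EReal)) :
    ∀ᶠ n in atTop, u n ≤ expVol d r n := by
  filter_upwards [eventually_lt_of_limsup_lt h] with n hn
  exact logRate_le_coe.1 hn.le

theorem eventually_expVol_le_of_lt_liminf {r : ℝ} {u : ℕ+ → ℝ≥0∞}
    (h : (r : EReal) < liminf (fun n => logRate d n (u n)) atTop) :
    ∀ᶠ n in atTop, expVol d r n ≤ u n := by
  filter_upwards [eventually_lt_of_lt_liminf h] with n hn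
  exact coe_le_logRate.1 hn.le

theorem liminf_logRate_mono {u v : ℕ+ → ℝ≥0∞} (h : ∀ n, u n ≤ v n) :
    liminf (fun n => logRate d n (u n)) atTop ≤ liminf (fun n => logRate d n (v n)) atTop :=
  liminf_le_liminf (Eventually.of_forall fun n => logRate_mono (h n))

variable {ν : ℕ+ → Measure Z} {𝒱 : Z → Set (Set Z)}

theorem iSup_interior_entropy_le [TopologicalSpace Z]
    (hnhds : ∀ x U, U ∈ 𝓝 x → ∃ V ∈ 𝒱 x, V ⊆ U) (A : Set Z) :
    ⨆ x ∈ interior A, entropy d ν 𝒱 x ≤ liminf (fun n => logRate d n (ν n A)) atTop := by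
  refine iSup₂_le fun x hx => ?_
  obtain ⟨V, hV, hVA⟩ := hnhds x A (mem_interior_iff_mem_nhds.1 hx)
  exact (iInf₂_le V hV).trans (liminf_logRate_mono fun n => measure_mono hVA)

/-- The Ruelle–Lanford property: the upper rate at small neighbourhoods is controlled by the lower
rate at larger ones. -/
def RuelleLanford (d : ℕ) (ν : ℕ+ → Measure Z) (𝒱 : Z → Set (Set Z)) : Prop :=
  ∀ x, ∀ V ∈ 𝒱 x, ∃ V' ∈ 𝒱 x, limsup (fun n => logRate d n (ν n V')) atTop ≤
    liminf (fun n => logRate d n (ν n V)) atTop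

/-- The entropy is built from a liminf, whereas a union bound needs control for all large `n`; the
Ruelle–Lanford property supplies it. -/
theorem RuelleLanford.exists_eventually_le (h : RuelleLanford d ν 𝒱) {x : Z} {r : ℝ}
    (hx : entropy d ν 𝒱 x < r) : ∃ V ∈ 𝒱 x, ∀ᶠ n in atTop, ν n V ≤ expVol d r n := by
  simp only [entropy, iInf_lt_iff] at hx
  obtain ⟨V, hV, hlt⟩ := hx
  obtain ⟨V', hV', hle⟩ := h x V hV
  exact ⟨V', hV', eventually_le_expVol_of_limsup_lt (hle.trans_lt hlt)⟩

/-- A finite cover of `closure (K ∩ D)` by neighbourhoods of small mass suffices: `hD` lets the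
cover of `K ∩ D` bound the mass of `K`, and it says that `ν n` is carried by `D` without asking `D`
to be measurable. -/
theorem RuelleLanford.weakUpperBoundOn [τ : TopologicalSpace Z] (hd : 0 < d)
    (h : RuelleLanford d ν 𝒱) (hnhds : ∀ x, ∀ V ∈ 𝒱 x, V ∈ 𝓝 x)
    (hmeas : ∀ x, ∀ V ∈ 𝒱 x, MeasurableSet V) {D : Set Z}
    (hD : ∀ n K U, MeasurableSet K → MeasurableSet U → K ∩ D ⊆ U → ν n K ≤ ν n U) :
    WeakUpperBoundOn d τ ν (entropy d ν 𝒱) D := by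
  intro K hK hcomp
  refine EReal.le_of_forall_lt_iff_le.1 fun r hr => ?_
  have h1 : ∀ x ∈ closure (K ∩ D), ∃ V ∈ 𝒱 x, ∀ᶠ n in atTop, ν n V ≤ expVol d r n := by
    intro x hx
    refine h.exists_eventually_le (lt_of_le_of_lt ?_ hr)
    exact le_iSup₂_of_le x (closure_mono Set.inter_subset_left hx) le_rfl
  choose! V hV hVn using h1
  obtain ⟨t, ht, hcov⟩ := hcomp.elim_nhds_subcover V fun x hx => hnhds x _ (hV x hx)
  refine limsup_logRate_le fun η hη => ?_
  filter_upwards [eventually_natCast_le_expVol hd t.card hη,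
    (Finset.eventually_all t).2 fun x hx => hVn x (ht x hx)] with n hn1 hn2
  calc ν n K ≤ ν n (⋃ x ∈ t, V x) := hD n K _ hK
        (Finset.measurableSet_biUnion _ fun x hx => hmeas x _ (hV x (ht x hx)))
        (subset_closure.trans hcov)
    _ ≤ ∑ x ∈ t, ν n (V x) := measure_biUnion_finset_le _ _
    _ ≤ t.card • expVol d r n := Finset.sum_le_card_nsmul _ _ _ hn2
    _ ≤ expVol d η n * expVol d r n := by rw [nsmul_eq_mul]; gcongr
    _ = expVol d (r + η) n := by rw [← expVol_add, add_comm]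

theorem RuelleLanford.weakLDP [τ : TopologicalSpace Z] (hd : 0 < d)
    (h : RuelleLanford d ν 𝒱) (hnhds : ∀ x U, U ∈ 𝓝 x ↔ ∃ V ∈ 𝒱 x, V ⊆ U)
    (hmeas : ∀ x, ∀ V ∈ 𝒱 x, MeasurableSet V) : WeakLDP d τ ν (entropy d ν 𝒱) :=
  ⟨fun A _ => iSup_interior_entropy_le (fun x U => (hnhds x U).1) A,
    h.weakUpperBoundOn hd (fun x V hV => (hnhds x V).2 ⟨V, hV, subset_rfl⟩) hmeas
      fun n K U _ _ hKU => measure_mono (by simpa using hKU)⟩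

end AbstractLDP

/-! ### Projected systems -/

section Proj

variable {d : ℕ} {X Y : Type*} [AddCommGroup X] [Module ℝ X] [MeasurableSpace X]
  [AddCommGroup Y] [Module ℝ Y] [MeasurableSpace Y] {μ : BoxMeasures d X} {f : X →ₗ[ℝ] Y}

theorem BoxMeasures.proj_apply (μ : BoxMeasures d X) (hf : Measurable f) (Λ : Box d)
    {A : Set (Config d Y)} (hA : MeasurableSet[siteSigma Y Λ.sites] A) :
    μ.proj f Λ A = μ Λ ((fun (σ : Config d X) z => f (σ z)) ⁻¹' A) :=
  @Measure.map_apply _ _ (siteSigma X Λ.sites) (siteSigma Y Λ.sites) _ _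
    (measurable_configMap f hf Λ.sites) _ hA

theorem IsCompatibleInvariant.proj (hμ : IsCompatibleInvariant μ) (hf : Measurable f) :
    IsCompatibleInvariant (μ.proj f) where
  prob Λ := by
    rw [BoxMeasures.proj_apply μ hf Λ (@MeasurableSet.univ _ (siteSigma Y Λ.sites)),
      Set.preimage_univ, hμ.prob]
  compatible Λ₁ Λ₂ h A hA := by
    rw [BoxMeasures.proj_apply μ hf _ hA, BoxMeasures.proj_apply μ hf _ (siteSigma_mono h _ hA)]
    exact hμ.compatible _ _ h _ (measurable_configMap f hf _ hA)
  invariant Λ z A hA := by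
    have hm : MeasurableSet[siteSigma Y (Λ.translate z).sites] (shift z ⁻¹' A) :=
      measurable_shift (fun v hv => Box.mem_sites_translate.2 (by simpa using hv)) hA
    rw [shiftSet_eq_preimage, BoxMeasures.proj_apply μ hf _ hA, BoxMeasures.proj_apply μ hf _ hm]
    exact hμ.measure_shift Λ z (measurable_configMap f hf _ hA)

theorem CarriedBy.proj {D : Set X} (h : CarriedBy μ (configsIn d D)) (hf : Measurable f) :
    CarriedBy (μ.proj f) (configsIn d (f '' D)) := by
  intro Λ A B hA hB hAB
  rw [BoxMeasures.proj_apply μ hf _ hA, BoxMeasures.proj_apply μ hf _ hB]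
  refine h Λ _ _ (measurable_configMap f hf _ hA) (measurable_configMap f hf _ hB) ?_
  ext σ
  refine and_congr_left fun hσ => ?_
  have h1 : (fun z => f (σ z)) ∈ configsIn d (f '' D) := fun z => ⟨_, hσ z, rfl⟩
  have h2 := Set.ext_iff.1 hAB fun z => f (σ z)
  simp only [Set.mem_inter_iff, h1, and_true] at h2
  exact h2

theorem cramerSeq_proj (μ : BoxMeasures d X) (hf : Measurable f) (n : ℕ+) :
    cramerSeq (μ.proj f) n = (cramerSeq μ n).map f := by
  ext A hA
  rw [cramerSeq_apply _ _ hA, Measure.map_apply hf hA, cramerSeq_apply _ _ (hf hA),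
    BoxMeasures.proj_apply μ hf _ (measurable_blockMean subset_rfl hA)]
  congr 1
  ext σ
  simp [blockMean, map_sum]

/-- The Cramér sequence of a system carried by `D^{ℤ^d}`, with `D` convex, is carried by `D`. -/
theorem CarriedBy.cramerSeq_le {D : Set X} (h : CarriedBy μ (configsIn d D)) (hD : Convex ℝ D)
    (n : ℕ+) {K U : Set X} (hK : MeasurableSet K) (hU : MeasurableSet U) (hKU : K ∩ D ⊆ U) :
    cramerSeq μ n K ≤ cramerSeq μ n U := by
  -- Convexity keeps the block means of configurations with values in `D` inside `D`, so the two
  -- events have the same trace on `D^{ℤ^d}`.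
  have h1 : cramerSeq μ n K = cramerSeq μ n (K ∩ U) := by
    rw [cramerSeq_apply _ _ hK, cramerSeq_apply _ _ (hK.inter hU)]
    refine h _ _ _ (measurable_blockMean subset_rfl hK)
      (measurable_blockMean subset_rfl (hK.inter hU)) ?_
    ext σ
    refine and_congr_left fun hσ => ⟨fun hk => ⟨hk, hKU ⟨hk, ?_⟩⟩, fun hk => hk.1⟩
    rw [blockMean, Finset.smul_sum]
    refine hD.sum_mem (fun _ _ => by positivity) ?_ fun z _ => hσ z
    rw [Finset.sum_const, nsmul_eq_mul, card_cube]
    have : ((n : ℕ) : ℝ) ≠ 0 := by exact_mod_cast n.pos.ne'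
    push_cast
    field_simp
  rw [h1]
  exact measure_mono Set.inter_subset_right

/-- The trace on a set that carries `ν`. -/
theorem traceMeasure_preimage {Z : Type*} [MeasurableSpace Z] {ν : Measure Z} {D : Set Z}
    (h : ∀ K U, MeasurableSet K → MeasurableSet U → K ∩ D ⊆ U → ν K ≤ ν U) {B : Set Z}
    (hB : MeasurableSet B) : traceMeasure ν D (((↑) : D → Z) ⁻¹' B) = ν B := by
  rw [traceMeasure, toMeasure_apply _ _ (measurable_subtype_coe hB), OuterMeasure.comap_apply,
    Subtype.image_preimage_coe, Set.inter_comm]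
  refine le_antisymm (measure_mono Set.inter_subset_left) ?_
  change ν B ≤ ν (B ∩ D)
  -- `B ∩ D` need not be measurable; `h` applies to its measurable hull.
  rw [← measure_toMeasurable (B ∩ D)]
  exact h B _ hB (measurableSet_toMeasurable _ _) (subset_toMeasurable _ _)

end Proj

/-! ### Entropy and pressure on a measurable locally convex space -/

section SingleSpace

variable {d : ℕ} {X : Type*} [AddCommGroup X] [Module ℝ X] [MeasurableSpace X]
  {μ : BoxMeasures d X}

theorem IsCompatibleInvariant.entropy_le_zero (hμ : IsCompatibleInvariant μ) {C : Set (Set X)}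
    (hC : C.Nonempty) (x : X) : entropy d (cramerSeq μ) (translates C) x ≤ 0 := by
  obtain ⟨A, hA⟩ := hC
  refine (iInf₂_le (x +ᵥ A) ⟨A, hA, rfl⟩).trans ?_
  have h : ∀ n : ℕ+, logRate d n (cramerSeq μ n (x +ᵥ A)) ≤ ((0 : ℝ) : EReal) := fun n => by
    have := hμ.isProbabilityMeasure_cramerSeq n
    rw [logRate_le_coe]
    simpa [expVol] using prob_le_one
  calc liminf (fun n => logRate d n (cramerSeq μ n (x +ᵥ A))) atTop
      ≤ liminf (fun _ : ℕ+ => ((0 : ℝ) : EReal)) atTop :=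
        liminf_le_liminf (Eventually.of_forall h)
    _ = 0 := by simp

/-- The Ruelle–Lanford property for the balls of a measurable internal seminorm. -/
theorem limsup_cramerSeq_ball_le (hd : 0 < d) (hX : StableSigma X)
    (hμ : IsCompatibleInvariant μ) (hdec : LowerDecoupled μ) (hcon : LocallyControlled μ)
    {q : Seminorm ℝ X} (hq : q.ball 0 1 ∈ measurableInternal X) (x : X) :
    limsup (fun n => logRate d n (cramerSeq μ n (q.ball x 1))) atTop ≤
      liminf (fun n => logRate d n (cramerSeq μ n (q.ball x 2))) atTop := by
  refine EReal.ge_of_forall_gt_iff_ge.1 fun r hr => le_liminf_logRate fun η hη => ?_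
  have h1 := frequently_lt_of_lt_limsup (by isBoundedDefault) hr
  -- The limsup gives a good lower bound for arbitrarily large `m`; the ball estimate accepts every
  -- large `m`, so one good `m` serves all large `n`.
  obtain ⟨m, hm, hm'⟩ := (h1.and_eventually (eventually_le_cramerSeq_ball hd hX hμ hdec hcon hq
    x x zero_le_one le_rfl r r hη)).exists
  have h2 := hm' (coe_le_logRate.1 hm.le) (coe_le_logRate.1 hm.le)
  simpa using h2

variable {E : MeasurableLCS X}

/-- The normalisation makes `C` the ball of radius 2, to match the passage from radius 1 to radius 2
in the ball estimate. -/
theorem MeasurableLCS.exists_seminorm (E : MeasurableLCS X) {C : Set X} (hC : C ∈ E.C₀) :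
    ∃ q : Seminorm ℝ X, q.ball 0 1 ∈ E.C₀ ∧ ∀ x, q.ball x 2 = x +ᵥ C ∧
      q.ball x 1 = x +ᵥ (1 / 2 : ℝ) • C := by
  have h2 := E.dilate (1 / 2) (by norm_num) C hC
  obtain ⟨q, hq⟩ := E.isSeminormBase.ball _ h2
  have h3 : C = q.ball 0 2 := by
    have := smul_ball_zero_one q two_ne_zero
    rw [← hq, smul_smul] at this
    norm_num at this
    exact this
  refine ⟨q, hq ▸ h2, fun x => ⟨?_, ?_⟩⟩
  · rw [h3, vadd_ball_zero]
  · rw [hq, vadd_ball_zero]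

theorem limsup_cramerSeq_half_le (hd : 0 < d) (hμ : IsCompatibleInvariant μ)
    (hdec : LowerDecoupled μ) (hcon : LocallyControlled μ) {C : Set X} (hC : C ∈ E.C₀) (x : X) :
    limsup (fun n => logRate d n (cramerSeq μ n (x +ᵥ (1 / 2 : ℝ) • C))) atTop ≤
      liminf (fun n => logRate d n (cramerSeq μ n (x +ᵥ C))) atTop := by
  obtain ⟨q, hq, h⟩ := E.exists_seminorm hC
  rw [← (h x).1, ← (h x).2]
  exact limsup_cramerSeq_ball_le hd E.stable hμ hdec hcon (E.internal hq) x

theorem ruelleLanford_cramerSeq (hd : 0 < d) (hμ : IsCompatibleInvariant μ)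
    (hdec : LowerDecoupled μ) (hcon : LocallyControlled μ) :
    RuelleLanford d (cramerSeq μ) (translates E.C₀) := by
  rintro x - ⟨C, hC, rfl⟩
  exact ⟨_, ⟨_, E.dilate (1 / 2) (by norm_num) C hC, rfl⟩,
    limsup_cramerSeq_half_le hd hμ hdec hcon hC x⟩

/-- The entropy is concave. -/
theorem coe_le_entropy_convexCombination (hd : 0 < d) (hμ : IsCompatibleInvariant μ)
    (hdec : LowerDecoupled μ) (hcon : LocallyControlled μ) {x x' : X} {r r' t : ℝ} (ht0 : 0 ≤ t)
    (ht1 : t ≤ 1) (hr : (r : EReal) ≤ entropy d (cramerSeq μ) (translates E.C₀) x)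
    (hr' : (r' : EReal) ≤ entropy d (cramerSeq μ) (translates E.C₀) x') :
    ((t * r + (1 - t) * r' : ℝ) : EReal) ≤
      entropy d (cramerSeq μ) (translates E.C₀) (t • x + (1 - t) • x') := by
  refine le_iInf₂ ?_
  rintro - ⟨C, hC, rfl⟩
  obtain ⟨q, hq, h⟩ := E.exists_seminorm hC
  rw [← (h _).1]
  have hlow : ∀ {y : X} {ρ δ : ℝ}, (ρ : EReal) ≤ entropy d (cramerSeq μ) (translates E.C₀) y →
      0 < δ → ∀ᶠ m in atTop, expVol d (ρ - δ) m ≤ cramerSeq μ m (q.ball y 1) := by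
    intro y ρ δ hρ hδ
    refine eventually_expVol_le_of_lt_liminf (lt_of_lt_of_le ?_ (hρ.trans
      (iInf₂_le (q.ball y 1) ⟨_, hq, (vadd_ball_zero q y 1).symm⟩)))
    exact_mod_cast sub_lt_self ρ hδ
  refine le_liminf_logRate fun η hη => ?_
  have hη2 := half_pos hη
  obtain ⟨m, hm1, hm2, hm3⟩ := ((hlow hr hη2).and ((hlow hr' hη2).and
    (eventually_le_cramerSeq_ball hd E.stable hμ hdec hcon (E.internal hq) x x' ht0 ht1
      (r - η / 2) (r' - η / 2) hη2))).exists
  have := hm3 hm1 hm2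
  have e : t * (r - η / 2) + (1 - t) * (r' - η / 2) - η / 2 = t * r + (1 - t) * r' - η := by ring
  rwa [e] at this

/-- The entropy is upper semicontinuous. -/
theorem exists_forall_entropy_lt {x₀ : X} {a : EReal}
    (h : entropy d (cramerSeq μ) (translates E.C₀) x₀ < a) :
    ∃ q : Seminorm ℝ X, q.ball 0 1 ∈ E.C₀ ∧ ∀ x ∈ q.ball x₀ 1,
      entropy d (cramerSeq μ) (translates E.C₀) x < a := by
  have h' := h
  simp only [entropy, iInf_lt_iff] at h'
  obtain ⟨-, ⟨C, hC, rfl⟩, hlt⟩ := h'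
  obtain ⟨q, hq, h2⟩ := E.exists_seminorm hC
  refine ⟨q, hq, fun x hx => lt_of_le_of_lt ?_ hlt⟩
  refine (iInf₂_le (q.ball x 1) ⟨_, hq, (vadd_ball_zero q x 1).symm⟩).trans
    (liminf_logRate_mono fun n => measure_mono ?_)
  rw [← (h2 x₀).1]
  intro y hy
  rw [Seminorm.mem_ball] at hx hy ⊢
  have := map_add_le_add q (y - x) (x - x₀)
  rw [sub_add_sub_cancel] at this
  linarith

theorem lintegral_tilt_univ (μ : BoxMeasures d X) {ℓ : X →ₗ[ℝ] ℝ} (hℓ : Measurable ℓ) (n : ℕ+) :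
    ∫⁻ σ, tilt d ℓ Set.univ n σ ∂(μ (cube d n)) =
      ∫⁻ x, ENNReal.ofReal (Real.exp (vol d n * ℓ x)) ∂(cramerSeq μ n) := by
  rw [lintegral_cramerSeq μ n (by fun_prop)]
  exact lintegral_congr fun σ => Set.indicator_of_mem
    (s := {σ : Config d X | ∀ v ∈ (cube d n).sites, σ v ∈ Set.univ}) (fun _ _ => Set.mem_univ _) _

theorem MeasurableLCS.exists_seminorm_of_mem_dualOf (E : MeasurableLCS X) {ℓ : X →ₗ[ℝ] ℝ}
    (hℓ : ℓ ∈ dualOf E.topology) : ∃ q : Seminorm ℝ X, q.ball 0 1 ∈ E.C₀ ∧ ∀ x, |ℓ x| ≤ q x := by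
  obtain ⟨C, hC, hb⟩ := E.isSeminormBase.mem_dualOf_iff.1 hℓ
  obtain ⟨q, rfl⟩ := E.isSeminormBase.ball C hC
  exact ⟨q, hC, abs_le_seminorm hb⟩

theorem MeasurableLCS.mem_dualOf (E : MeasurableLCS X) {q : Seminorm ℝ X}
    (hq : q.ball 0 1 ∈ E.C₀) {ℓ : X →ₗ[ℝ] ℝ} {M : ℝ} (hℓ : ∀ x, |ℓ x| ≤ M * q x) :
    ℓ ∈ dualOf E.topology := by
  refine E.isSeminormBase.mem_dualOf_iff.2 ⟨(|M| + 1)⁻¹ • q.ball 0 1,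
    E.dilate _ (by positivity) _ hq, ?_⟩
  rintro - ⟨y, hy, rfl⟩
  have h1 := hℓ y
  rw [Seminorm.mem_ball_zero] at hy
  have h2 : M * q y ≤ (|M| + 1) * 1 := by
    refine mul_le_mul ?_ hy.le (apply_nonneg q y) (by positivity)
    linarith [le_abs_self M]
  rw [map_smul, smul_eq_mul, abs_mul, abs_of_pos (by positivity), inv_mul_le_iff₀ (by positivity)]
  exact h1.trans h2

/-- The limit defining the pressure exists. -/
theorem tendsto_logLaplace (hd : 0 < d) (hμ : IsCompatibleInvariant μ)
    (hdec : LowerDecoupled μ) (hcon : LocallyControlled μ) {ℓ : X →ₗ[ℝ] ℝ}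
    (hℓ : ℓ ∈ dualOf E.topology) :
    Tendsto (logLaplace d (cramerSeq μ) ℓ) atTop (𝓝 (pressure d (cramerSeq μ) ℓ)) := by
  obtain ⟨q, hq, hℓq⟩ := E.exists_seminorm_of_mem_dualOf hℓ
  have hm := E.dual_measurable ℓ hℓ
  obtain ⟨T, κ, hT, hκ, hQm, hQ⟩ := hcon.exists_bound E.stable hμ (E.internal hq)
  refine tendsto_of_le_liminf_of_limsup_le ?_ le_rfl
  refine EReal.ge_of_forall_gt_iff_ge.1 fun a ha => le_liminf_logRate fun η hη => ?_
  have h1 := frequently_lt_of_lt_limsup (by isBoundedDefault) ha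
  obtain ⟨m, hma, hm'⟩ := (h1.and_eventually
    (eventually_le_lintegral_tilt hd hμ hdec hm hT.le hκ a hη)).exists
  have h2 := hm' Set.univ _ MeasurableSet.univ hQm (Set.subset_univ _) (fun y hy => ?_) hQ ?_
  · filter_upwards [h2] with n hn
    rwa [lintegral_tilt_univ μ hm] at hn
  · rw [Seminorm.mem_ball_zero] at hy
    linarith [neg_abs_le (ℓ y), hℓq y]
  · rw [lintegral_tilt_univ μ hm]
    exact coe_le_logRate.1 hma.le

/-- Forcing all sites into a ball given by local control costs `κ` per site, and there `ℓ` is at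
least `-T`. The result is needed where the entropy is `⊥`, since `⊥ - ⊥ = ⊥` in `EReal`. -/
theorem pressure_ne_bot (hμ : IsCompatibleInvariant μ) (hcon : LocallyControlled μ)
    {ℓ : X →ₗ[ℝ] ℝ} (hℓ : ℓ ∈ dualOf E.topology) : pressure d (cramerSeq μ) ℓ ≠ ⊥ := by
  obtain ⟨q, hq, hℓq⟩ := E.exists_seminorm_of_mem_dualOf hℓ
  have hm := E.dual_measurable ℓ hℓ
  obtain ⟨T, κ, hT, hκ, hQm, hQ⟩ := hcon.exists_bound E.stable hμ (E.internal hq)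
  have key : ∀ n, ((-κ - T : ℝ) : EReal) ≤ logLaplace d (cramerSeq μ) ℓ n := by
    intro n
    rw [logLaplace, coe_le_logRate]
    change _ ≤ ∫⁻ x, ENNReal.ofReal (Real.exp (vol d n * ℓ x)) ∂(cramerSeq μ n)
    have h1 := hQ.lintegral_prod_le hμ hQm (Λ := cube d n) subset_rfl (G := fun _ => 1)
      (@measurable_const _ _ _ (siteSigma X _) _)
    have h2 : expVol d (-κ) n =
        ENNReal.ofReal (Real.exp (-κ)) ^ (cube d n).sites.card := by
      rw [expVol, ← ENNReal.ofReal_pow (Real.exp_pos _).le, ← Real.exp_nat_mul, mul_comm]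
      rfl
    rw [lintegral_one, hμ.prob, mul_one, ← h2] at h1
    rw [sub_eq_neg_add, expVol_add]
    refine (mul_le_mul_right h1 _).trans ?_
    rw [← lintegral_const_mul' _ _ (expVol_ne_top _ _), lintegral_cramerSeq μ n (by fun_prop)]
    refine lintegral_mono fun σ => ?_
    by_cases hz : ∃ v ∈ (cube d n).sites, σ v ∉ q.ball 0 T
    · obtain ⟨v, hv, hv'⟩ := hz
      rw [Finset.prod_eq_zero (i := v) hv (Set.indicator_of_notMem hv' _), mul_zero, mul_zero]
      exact zero_le
    push Not at hz
    rw [Finset.prod_eq_one fun v hv => Set.indicator_of_mem (hz v hv) _, mul_one, mul_one]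
    refine ENNReal.ofReal_le_ofReal (Real.exp_le_exp.2 ?_)
    have h3 : vol d n * ℓ (blockMean (cube d n) σ) = ∑ v ∈ (cube d n).sites, ℓ (σ v) := by
      have := congrArg ℓ (vol_smul_blockMean n σ)
      simpa [map_sum] using this
    have h4 : (cube d n).sites.card • (-T) ≤ ∑ v ∈ (cube d n).sites, ℓ (σ v) := by
      refine Finset.card_nsmul_le_sum _ _ _ fun v hv => ?_
      have := hz v hv
      rw [Seminorm.mem_ball_zero] at this
      linarith [neg_abs_le (ℓ (σ v)), hℓq (σ v)]
    rw [h3, mul_comm]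
    rwa [nsmul_eq_mul] at h4
  have h : ((-κ - T : ℝ) : EReal) ≤ pressure d (cramerSeq μ) ℓ :=
    le_limsup_of_frequently_le (Frequently.of_forall key) (by isBoundedDefault)
  exact ne_bot_of_le_ne_bot (EReal.coe_ne_bot _) h

/-- The Fenchel–Young inequality between entropy and pressure. -/
theorem coe_add_le_pressure {ℓ : X →ₗ[ℝ] ℝ} (hℓ : ℓ ∈ dualOf E.topology) {x : X} {ρ : ℝ}
    (hρ : (ρ : EReal) ≤ entropy d (cramerSeq μ) (translates E.C₀) x) :
    ((ℓ x + ρ : ℝ) : EReal) ≤ pressure d (cramerSeq μ) ℓ := by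
  obtain ⟨q, hq, hℓq⟩ := E.exists_seminorm_of_mem_dualOf hℓ
  refine le_trans (le_liminf_logRate (r := ℓ x + ρ) fun η hη => ?_) liminf_le_limsup
  have hδ : 0 < η / 2 := half_pos hη
  -- Half of `η` bounds the oscillation of `ℓ` on the ball, the other half is lost on the rate of
  -- its mass.
  have hC := E.dilate (η / 2) hδ.ne' _ hq
  have h1 : ∀ᶠ n in atTop, expVol d (ρ - η / 2) n ≤
      cramerSeq μ n (x +ᵥ (η / 2) • q.ball 0 1) := by
    refine eventually_expVol_le_of_lt_liminf (lt_of_lt_of_le ?_ (hρ.trans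
      (iInf₂_le _ ⟨_, hC, rfl⟩)))
    exact_mod_cast sub_lt_self ρ hδ
  filter_upwards [h1] with n hn
  have hmeas : MeasurableSet (x +ᵥ (η / 2) • q.ball 0 1) := E.stable.vadd x _ (E.internal hC).2
  have e : ℓ x + ρ - η = (ℓ x - η / 2) + (ρ - η / 2) := by ring
  rw [e, expVol_add]
  calc _ ≤ expVol d (ℓ x - η / 2) n * cramerSeq μ n (x +ᵥ (η / 2) • q.ball 0 1) := by gcongr
    _ = ∫⁻ _ in x +ᵥ (η / 2) • q.ball 0 1, expVol d (ℓ x - η / 2) n ∂(cramerSeq μ n) := by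
      rw [setLIntegral_const]
    _ ≤ ∫⁻ y in x +ᵥ (η / 2) • q.ball 0 1,
        ENNReal.ofReal (Real.exp (vol d n * ℓ y)) ∂(cramerSeq μ n) := by
      refine setLIntegral_mono' hmeas fun y hy => ?_
      rw [smul_ball_zero_one q hδ.ne', vadd_ball_zero, Seminorm.mem_ball, abs_of_pos hδ] at hy
      refine ENNReal.ofReal_le_ofReal (Real.exp_le_exp.2 ?_)
      rw [mul_comm]
      refine mul_le_mul_of_nonneg_left ?_ (vol_pos n).le
      have := (neg_abs_le _).trans' (neg_le_neg (hℓq (y - x)))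
      rw [map_sub ℓ] at this
      linarith
    _ ≤ _ := setLIntegral_le_lintegral _ _

end SingleSpace

/-! ### Duality under local convex-tightness -/

section Truncation

/-- An integral larger than `b` stays so when restricted to a set of small complement. -/
theorem exists_pos_lt_setLIntegral {Ω : Type*} {m0 : MeasurableSpace Ω} {μ : Measure Ω}
    {f : Ω → ℝ≥0∞} {b : ℝ≥0∞} (hb : b < ∫⁻ ω, f ω ∂μ) :
    ∃ δ : ℝ≥0, 0 < δ ∧ ∀ A, MeasurableSet A → μ Aᶜ ≤ δ → b < ∫⁻ ω in A, f ω ∂μ := by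
  -- The integral of `f` may be infinite; a simple function below `f` with finite values is bounded
  -- and still has integral above `b`. Discarding a set of mass `δ` then costs at most `δ * C`, less
  -- than the gap.
  rw [lintegral_eq_nnreal] at hb
  simp only [lt_iSup_iff] at hb
  obtain ⟨φ, hφ, hlt⟩ := hb
  obtain ⟨C, hC⟩ := φ.exists_forall_le
  rw [← SimpleFunc.lintegral_eq_lintegral] at hlt
  simp only [SimpleFunc.map_apply] at hlt
  obtain ⟨δ, hδ, hδC⟩ := ENNReal.exists_nnreal_pos_mul_lt (a := (C : ℝ≥0∞)) ENNReal.coe_ne_top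
    (tsub_pos_of_lt hlt).ne'
  refine ⟨δ, hδ, fun A hA hAδ => ?_⟩
  by_contra! hcon
  have h1 : ∫⁻ ω, (φ ω : ℝ≥0∞) ∂μ ≤ b + δ * C := by
    rw [← lintegral_add_compl _ hA]
    refine add_le_add ((lintegral_mono hφ).trans hcon) ?_
    calc ∫⁻ ω in Aᶜ, (φ ω : ℝ≥0∞) ∂μ ≤ ∫⁻ _ in Aᶜ, (C : ℝ≥0∞) ∂μ :=
          lintegral_mono fun ω => ENNReal.coe_le_coe.2 (hC ω)
      _ = C * μ Aᶜ := by rw [setLIntegral_const]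
      _ ≤ δ * C := by rw [mul_comm]; gcongr
  have h2 : b + δ * C < b + (∫⁻ ω, (φ ω : ℝ≥0∞) ∂μ - b) :=
    ENNReal.add_lt_add_left hlt.ne_top hδC
  rw [add_tsub_cancel_of_le hlt.le] at h2
  exact absurd h1 (not_le.2 h2)

theorem setLIntegral_biUnion_finset_le {Ω ι : Type*} {m0 : MeasurableSpace Ω} (μ : Measure Ω)
    (f : Ω → ℝ≥0∞) (t : Finset ι) (W : ι → Set Ω) :
    ∫⁻ ω in ⋃ i ∈ t, W i, f ω ∂μ ≤ ∑ i ∈ t, ∫⁻ ω in W i, f ω ∂μ := by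
  classical
  induction t using Finset.induction_on with
  | empty => simp
  | insert i t hi ih =>
    rw [Finset.set_biUnion_insert, Finset.sum_insert hi]
    exact (lintegral_union_le _ _ _).trans (add_le_add le_rfl ih)

end Truncation

/-! ### Separation of a hypograph from a cylinder. -/

section Separation

/-- Hahn–Banach separates `H` from the open convex cylinder over the unit ball and above height `a`.
The cylinder is unbounded upwards, which forces the sign of `c`; the strict inequality at `x₀` stays
useful when the hyperplane is vertical, `c = 0`. -/
theorem exists_separation_of_norm {V : Type*} [SeminormedAddCommGroup V] [NormedSpace ℝ V]
    {H : Set (V × ℝ)} (hH : Convex ℝ H) {x₀ : V} {a : ℝ}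
    (hdisj : ∀ p ∈ H, ‖p.1 - x₀‖ < 1 → p.2 ≤ a) :
    ∃ (g : V →ₗ[ℝ] ℝ) (c u M : ℝ), 0 ≤ c ∧ (∀ x, |g x| ≤ M * ‖x‖) ∧
      (∀ p ∈ H, u ≤ g p.1 - c * p.2) ∧ ∀ r, a < r → g x₀ - c * r < u := by
  obtain ⟨f, u, hf1, hf2⟩ := geometric_hahn_banach_open (s := Metric.ball x₀ 1 ×ˢ Set.Ioi a)
    ((convex_ball x₀ 1).prod (convex_Ioi a)) (Metric.isOpen_ball.prod isOpen_Ioi) hH (by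
      rw [Set.disjoint_left]
      rintro p ⟨h1, h2⟩ hp
      exact absurd (hdisj p hp (by rwa [Metric.mem_ball, dist_eq_norm] at h1)) (not_le.2 h2))
  let g : V →L[ℝ] ℝ := f.comp (ContinuousLinearMap.inl ℝ V ℝ)
  have hfg : ∀ x r, f (x, r) = g x + f (0, 1) * r := by
    intro x r
    have h1 : (x, r) = ContinuousLinearMap.inl ℝ V ℝ x + r • ((0 : V), (1 : ℝ)) := by simp
    rw [h1, map_add, map_smul, smul_eq_mul, mul_comm]
    rfl
  have hin : ∀ r, a < r → g x₀ + f (0, 1) * r < u := fun r hr => by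
    rw [← hfg]
    exact hf1 _ ⟨Metric.mem_ball_self one_pos, hr⟩
  refine ⟨g, -f (0, 1), u, ‖g‖, ?_, fun x => g.le_opNorm x, fun p hp => ?_, fun r hr => ?_⟩
  · by_contra! hcon
    have hpos : 0 < f (0, 1) := by linarith
    have h1 := hin (max (a + 1) ((u - g x₀) / f (0, 1))) (lt_of_lt_of_le (by linarith)
      (le_max_left _ _))
    have h2 : (u - g x₀) ≤ f (0, 1) * max (a + 1) ((u - g x₀) / f (0, 1)) := by
      rw [mul_comm, ← div_le_iff₀ hpos]
      exact le_max_right _ _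
    linarith
  · have := hf2 p hp
    rw [← Prod.mk.eta (p := p), hfg] at this
    simp only [ContinuousLinearMap.coe_coe]
    linarith
  · have := hin r hr
    simp only [ContinuousLinearMap.coe_coe]
    linarith

/-- Taking `q` itself as the norm makes the separating form bounded by a multiple of this one
seminorm. -/
theorem exists_separation_of_seminorm {V : Type*} [AddCommGroup V] [Module ℝ V] (q : Seminorm ℝ V)
    {H : Set (V × ℝ)} (hH : Convex ℝ H) {x₀ : V} {a : ℝ}
    (hdisj : ∀ p ∈ H, q (p.1 - x₀) < 1 → p.2 ≤ a) :
    ∃ (g : V →ₗ[ℝ] ℝ) (c u M : ℝ), 0 ≤ c ∧ (∀ x, |g x| ≤ M * q x) ∧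
      (∀ p ∈ H, u ≤ g p.1 - c * p.2) ∧ ∀ r, a < r → g x₀ - c * r < u := by
  let I : SeminormedAddCommGroup V := q.toAddGroupSeminorm.toSeminormedAddCommGroup
  let N : NormedSpace ℝ V := { norm_smul_le := fun r x => (map_smul_eq_mul q r x).le }
  exact exists_separation_of_norm hH hdisj

end Separation

/-! ### Upper bound of the pressure by the entropy, and duality. -/

section Duality

variable {d : ℕ} {X : Type*} [AddCommGroup X] [Module ℝ X] [MeasurableSpace X]
  {μ : BoxMeasures d X} {E : MeasurableLCS X}

theorem LocalLowerBound.measure_compl_le (hμ : IsCompatibleInvariant μ) {K : Set X}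
    (hK : MeasurableSet K) {β : ℝ≥0∞} (h : LocalLowerBound μ K β) (n : ℕ+) :
    μ (cube d n) {σ : Config d X | ∀ v ∈ (cube d n).sites, σ v ∈ K}ᶜ ≤
      (cube d n).sites.card * (1 - β) := by
  have := hμ.isProbabilityMeasure (cube d n)
  have h1 : {σ : Config d X | ∀ v ∈ (cube d n).sites, σ v ∈ K}ᶜ =
      ⋃ v ∈ (cube d n).sites, {σ : Config d X | σ v ∈ K}ᶜ := by
    ext σ
    simp
  rw [h1, ← nsmul_eq_mul]
  refine (measure_biUnion_finset_le _ _).trans (Finset.sum_le_card_nsmul _ _ _ fun v hv => ?_)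
  have hm : MeasurableSet[siteSigma X (cube d n).sites] {σ : Config d X | σ v ∈ K} :=
    measurable_eval_site hv hK
  rw [prob_compl_eq_one_sub hm]
  have h2 := h.translate hμ hK hv (@MeasurableSet.univ _ (siteSigma X _))
  rw [hμ.prob, mul_one, Set.inter_univ] at h2
  exact tsub_le_tsub_left h2 1

/-- Restricting the exponential moments to a convex-tight set only charges the neighbourhoods of
that set, since the averages stay in it. -/
theorem lintegral_tilt_le {D : Set X} (hcar : CarriedBy μ (configsIn d D))
    {ℓ : X →ₗ[ℝ] ℝ} (hℓ : Measurable ℓ) {K U : Set X} (hK : MeasurableSet K)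
    (hconv : Convex ℝ (K ∩ D)) (hU : MeasurableSet U) (hKU : K ∩ D ⊆ U) (n : ℕ+) :
    ∫⁻ σ, tilt d ℓ K n σ ∂(μ (cube d n)) ≤
      ∫⁻ x in U, ENNReal.ofReal (Real.exp (vol d n * ℓ x)) ∂(cramerSeq μ n) := by
  have hA := measurableSet_forall_mem (d := d) hK n
  have hB : MeasurableSet[siteSigma X (cube d n).sites] (blockMean (cube d n) ⁻¹' U) :=
    measurable_blockMean subset_rfl hU
  -- By convexity of `K ∩ D` this event misses every configuration with values in `D`, hence is null
  -- since the system is carried by `D^{ℤ^d}`.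
  have h0 : μ (cube d n) ({σ : Config d X | ∀ v ∈ (cube d n).sites, σ v ∈ K} \
      blockMean (cube d n) ⁻¹' U) = 0 := by
    rw [hcar (cube d n) _ ∅ (hA.diff hB) (@MeasurableSet.empty _ (siteSigma X _)), measure_empty]
    rw [Set.empty_inter, Set.eq_empty_iff_forall_notMem]
    rintro σ ⟨⟨h1, h2⟩, h3⟩
    refine h2 (hKU ?_)
    rw [blockMean, Finset.smul_sum]
    refine hconv.sum_mem (fun _ _ => by positivity) ?_ fun z hz => ⟨h1 z hz, h3 z⟩
    rw [Finset.sum_const, nsmul_eq_mul]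
    exact mul_inv_cancel₀ (vol_pos n).ne'
  have hF : Measurable fun x : X => ENNReal.ofReal (Real.exp (vol d n * ℓ x)) := by fun_prop
  rw [← lintegral_indicator hU, lintegral_cramerSeq μ n (hF.indicator hU)]
  refine lintegral_mono_ae ?_
  filter_upwards [measure_eq_zero_iff_ae_notMem.1 h0] with σ hσ
  by_cases h1 : ∀ v ∈ (cube d n).sites, σ v ∈ K
  · have h2 : blockMean (cube d n) σ ∈ U := by
      by_contra h2
      exact hσ ⟨h1, h2⟩
    rw [Set.indicator_of_mem h2]
    exact Set.indicator_le_self' (fun _ _ => zero_le) σ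
  · rw [tilt, Set.indicator_of_notMem
      (s := {σ : Config d X | ∀ v ∈ (cube d n).sites, σ v ∈ K}) h1]
    exact zero_le

/-- If the pressure exceeded `a > r`, some exponential moment at scale `m` would be large, and would
remain so with all sites of Λ(m) in a tight set `K`. Supermultiplicativity propagates this to large
`n`, with the same `K`. The averages then lie in the relatively compact `K ∩ D`, where a finite
cover adapted to the entropy and to `ℓ` gives a smaller upper bound. -/
theorem pressure_le_of_forall (hd : 0 < d) (hμ : IsCompatibleInvariant μ)
    (hdec : LowerDecoupled μ) (hcon : LocallyControlled μ) {D : Set X}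
    (hcar : CarriedBy μ (configsIn d D)) (htight : LocallyConvexTight E.topology μ D)
    {ℓ : X →ₗ[ℝ] ℝ} (hℓ : ℓ ∈ dualOf E.topology) {r : ℝ}
    (h : ∀ (x : X) (ρ : ℝ), (ρ : EReal) ≤ entropy d (cramerSeq μ) (translates E.C₀) x →
      ℓ x + ρ ≤ r) : pressure d (cramerSeq μ) ℓ ≤ r := by
  obtain ⟨q, hq, hℓq⟩ := E.exists_seminorm_of_mem_dualOf hℓ
  have hm := E.dual_measurable ℓ hℓ
  obtain ⟨T, κ, hT, hκ, hQm, hQ⟩ := hcon.exists_bound E.stable hμ (E.internal hq)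
  by_contra! hcontra
  obtain ⟨a, hra, hap⟩ := EReal.lt_iff_exists_real_btwn.1 hcontra
  have hra' : r < a := by exact_mod_cast hra
  -- Then `a - η = η + (r + 2 * η)`: the lower bound beats the upper one by `η`, which absorbs the
  -- cardinality of the cover.
  set η : ℝ := (a - r) / 4 with hη
  have hη0 : 0 < η := by rw [hη]; linarith
  have h1 := frequently_lt_of_lt_limsup (by isBoundedDefault) hap
  -- The scale `m` must be chosen before `K`, so the cost of also staying in `K` is fixed now: at
  -- worst the local probability is halved.
  have hκ' : 0 ≤ κ + Real.log 2 := add_nonneg hκ (Real.log_nonneg one_le_two)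
  obtain ⟨m, hma, hm'⟩ := (h1.and_eventually
    (eventually_le_lintegral_tilt hd hμ hdec hm hT.le hκ' a hη0)).exists
  have hma' : expVol d a m < ∫⁻ σ, tilt d ℓ Set.univ m σ ∂(μ (cube d m)) := by
    rw [lintegral_tilt_univ μ hm]
    exact coe_lt_logRate.1 hma
  obtain ⟨δ, hδ, hδA⟩ := exists_pos_lt_setLIntegral hma'
  have hvm := vol_pos (d := d) m
  -- The first term makes a union bound over Λ(m) at most `δ`; the second leaves half of the
  -- probability `exp (-κ)` of the control ball.
  set γ : ℝ := min (δ / vol d m) (Real.exp (-κ) / 2) with hγ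
  have hδ' : (0 : ℝ) < δ := hδ
  have hγ0 : 0 < γ := by positivity
  have hγ1 : γ ≤ Real.exp (-κ) / 2 := min_le_right _ _
  have hγ2 : γ * vol d m ≤ δ := (le_div_iff₀ hvm).1 (min_le_left _ _)
  obtain ⟨K, hK, hKconv, hKcomp, hKtight⟩ := htight γ hγ0
  have hKloc := hμ.localLowerBound hK hKtight
  have hγle : γ ≤ 1 := by
    have : Real.exp (-κ) ≤ 1 := Real.exp_le_one_iff.2 (by linarith)
    linarith
  have hsum : 1 ≤ ENNReal.ofReal (1 - γ) + ENNReal.ofReal γ := by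
    rw [← ENNReal.ofReal_add (by linarith) hγ0.le]
    simp
  have hQK := hQ.inter hμ hK hKloc hsum ENNReal.ofReal_ne_top
  have hQK' : LocalLowerBound μ (q.ball 0 T ∩ K)
      (ENNReal.ofReal (Real.exp (-(κ + Real.log 2)))) := by
    refine hQK.mono ?_
    rw [← ENNReal.ofReal_sub _ hγ0.le]
    refine ENNReal.ofReal_le_ofReal ?_
    rw [neg_add, Real.exp_add, Real.exp_neg (Real.log 2), Real.exp_log two_pos]
    linarith
  have hKint : expVol d a m ≤ ∫⁻ σ, tilt d ℓ K m σ ∂(μ (cube d m)) := by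
    have hA := measurableSet_forall_mem (d := d) hK m
    have h2 := hδA _ hA (by
      refine (hKloc.measure_compl_le hμ hK m).trans ?_
      rw [← ENNReal.ofReal_one, ← ENNReal.ofReal_sub _ (by linarith), sub_sub_cancel,
        ← ENNReal.ofReal_natCast, ← ENNReal.ofReal_mul (by positivity), ← ENNReal.ofReal_coe_nnreal]
      refine ENNReal.ofReal_le_ofReal ?_
      rw [mul_comm]
      exact hγ2)
    refine h2.le.trans_eq ?_
    rw [← lintegral_indicator hA]
    refine lintegral_congr fun σ => ?_
    by_cases hσ : ∀ v ∈ (cube d m).sites, σ v ∈ K <;> simp [tilt, Set.indicator, hσ]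
  have hev := hm' K _ hK (hQm.inter hK) Set.inter_subset_right (fun y hy => by
    have := hy.1
    rw [Seminorm.mem_ball_zero] at this
    linarith [neg_abs_le (ℓ y), hℓq y]) hQK' hKint
  -- Upper bound along a finite cover of the closure of `K ∩ D`.
  let _ := E.topology
  have hRL := ruelleLanford_cramerSeq (E := E) hd hμ hdec hcon
  have hcover : ∀ x : X, ∃ V, MeasurableSet V ∧ V ∈ 𝓝 x ∧
      ∀ᶠ n in atTop, cramerSeq μ n V ≤ expVol d (r + η - ℓ x) n := by
    intro x
    have hx : entropy d (cramerSeq μ) (translates E.C₀) x < ((r + η - ℓ x : ℝ) : EReal) := by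
      by_contra! hx
      have := h x _ hx
      linarith
    obtain ⟨-, ⟨C, hC, rfl⟩, hn⟩ := hRL.exists_eventually_le hx
    exact ⟨_, E.stable.vadd x _ (E.internal hC).2,
      E.isSeminormBase.mem_nhds_iff.2 ⟨C, hC, subset_rfl⟩, hn⟩
  choose V hVm hVn hV using hcover
  have hcont : Continuous ℓ := hℓ
  -- On `W x` the mass is at most `r + η - ℓ x` in exponent and `ℓ` is below `ℓ x + η`, so the
  -- tilted integral has exponent `r + 2 * η`, whatever `x`.
  let W : X → Set X := fun x => V x ∩ ℓ ⁻¹' Set.Iio (ℓ x + η)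
  have hWm : ∀ x, MeasurableSet (W x) := fun x => (hVm x).inter (hm measurableSet_Iio)
  obtain ⟨t, -, hcov⟩ := hKcomp.elim_nhds_subcover W fun x _ => Filter.inter_mem (hVn x)
    (hcont.continuousAt.preimage_mem_nhds (Iio_mem_nhds (by linarith)))
  -- The extra 1 in `t.card + 1` makes the final inequality strict.
  obtain ⟨n, hn1, hn2, hn3⟩ := (hev.and ((eventually_natCast_le_expVol hd (t.card + 1) hη0).and
    ((Finset.eventually_all t).2 fun x _ => hV x))).exists
  have hW : ∀ x ∈ t, ∫⁻ y in W x, ENNReal.ofReal (Real.exp (vol d n * ℓ y)) ∂(cramerSeq μ n) ≤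
      expVol d (r + 2 * η) n := by
    intro x hx
    calc ∫⁻ y in W x, ENNReal.ofReal (Real.exp (vol d n * ℓ y)) ∂(cramerSeq μ n)
        ≤ ∫⁻ _ in W x, expVol d (ℓ x + η) n ∂(cramerSeq μ n) := by
          refine setLIntegral_mono' (hWm x) fun y hy => ?_
          refine ENNReal.ofReal_le_ofReal (Real.exp_le_exp.2 ?_)
          rw [mul_comm]
          exact mul_le_mul_of_nonneg_right (le_of_lt hy.2) (vol_pos n).le
      _ = expVol d (ℓ x + η) n * cramerSeq μ n (W x) := setLIntegral_const _ _
      _ ≤ expVol d (ℓ x + η) n * expVol d (r + η - ℓ x) n := by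
          gcongr
          exact (measure_mono Set.inter_subset_left).trans (hn3 x hx)
      _ = _ := by rw [← expVol_add]; congr 1; ring
  have hfinal : expVol d (a - η) n ≤ t.card * expVol d (r + 2 * η) n :=
    calc expVol d (a - η) n ≤ _ := hn1
      _ ≤ ∫⁻ x in ⋃ x ∈ t, W x, ENNReal.ofReal (Real.exp (vol d n * ℓ x)) ∂(cramerSeq μ n) :=
        lintegral_tilt_le hcar hm hK hKconv
          (Finset.measurableSet_biUnion _ fun x _ => hWm x) (subset_closure.trans hcov) n
      _ ≤ ∑ x ∈ t, ∫⁻ y in W x, ENNReal.ofReal (Real.exp (vol d n * ℓ y)) ∂(cramerSeq μ n) :=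
        setLIntegral_biUnion_finset_le _ _ _ _
      _ ≤ t.card • expVol d (r + 2 * η) n := Finset.sum_le_card_nsmul _ _ _ hW
      _ = _ := nsmul_eq_mul _ _
  have hlt : (t.card : ℝ≥0∞) * expVol d (r + 2 * η) n < expVol d (a - η) n := by
    have e : a - η = η + (r + 2 * η) := by rw [hη]; ring
    rw [e, expVol_add η]
    refine ENNReal.mul_lt_mul_left (expVol_pos _ _).ne' (expVol_ne_top _ _) ?_
    refine lt_of_lt_of_le ?_ hn2
    exact_mod_cast Nat.lt_succ_self _
  exact absurd hfinal (not_le.2 hlt)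

/-- Under local convex-tightness, the entropy is minus the conjugate of the pressure. -/
theorem exists_pressure_le (hd : 0 < d) (hμ : IsCompatibleInvariant μ)
    (hdec : LowerDecoupled μ) (hcon : LocallyControlled μ) {D : Set X}
    (hcar : CarriedBy μ (configsIn d D)) (htight : LocallyConvexTight E.topology μ D)
    {x₀ : X} {a : ℝ} (ha : entropy d (cramerSeq μ) (translates E.C₀) x₀ < a) :
    ∃ ℓ ∈ dualOf E.topology, pressure d (cramerSeq μ) ℓ ≤ ((ℓ x₀ + a : ℝ) : EReal) := by
  set s := entropy d (cramerSeq μ) (translates E.C₀) with hs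
  obtain ⟨q, hq, hqa⟩ := exists_forall_entropy_lt ha
  have hconv : Convex ℝ {p : X × ℝ | (p.2 : EReal) ≤ s p.1} := by
    rintro ⟨x, r⟩ hx ⟨x', r'⟩ hx' t t' ht ht' htt'
    obtain rfl : t' = 1 - t := by linarith
    exact coe_le_entropy_convexCombination hd hμ hdec hcon ht (by linarith) hx hx'
  obtain ⟨g, c, u, M, hc, hgM, hgu, hgx⟩ := exists_separation_of_seminorm q hconv (x₀ := x₀) (a := a)
    fun p hp hpx => by
      have h1 := lt_of_le_of_lt hp (hqa p.1 (q.mem_ball.2 hpx))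
      exact_mod_cast h1.le
  have hdual : ∀ t : ℝ, t • g ∈ dualOf E.topology := fun t =>
    E.mem_dualOf hq (M := |t| * M) fun x => by
      rw [LinearMap.smul_apply, smul_eq_mul, abs_mul, mul_assoc]
      exact mul_le_mul_of_nonneg_left (hgM x) (abs_nonneg t)
  -- A vertical hyperplane separates `x₀` strictly from the points of finite entropy; as the entropy
  -- is at most 0, a large multiple of `-g` suffices. Otherwise division by `c` turns the hyperplane
  -- into the graph of an affine majorant of the entropy.
  rcases hc.eq_or_lt with rfl | hc
  · have h1 : g x₀ < u := by simpa using hgx (a + 1) (by linarith)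
    obtain ⟨T, hT, hTa⟩ : ∃ T : ℝ, 0 ≤ T ∧ -T * (u - g x₀) ≤ a := by
      refine ⟨|a| / (u - g x₀), div_nonneg (abs_nonneg a) (by linarith), ?_⟩
      rw [neg_mul, div_mul_cancel₀ _ (by linarith)]
      exact neg_abs_le a
    refine ⟨(-T) • g, hdual _, pressure_le_of_forall hd hμ hdec hcon hcar htight (hdual _)
      fun x ρ hρ => ?_⟩
    have h2 : ρ ≤ 0 := by
      have := hρ.trans (hμ.entropy_le_zero E.nonempty x)
      exact_mod_cast this
    have h3 : u ≤ g x := by simpa using hgu (x, ρ) hρ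
    simp only [LinearMap.smul_apply, smul_eq_mul]
    nlinarith
  · refine ⟨(-c⁻¹) • g, hdual _, pressure_le_of_forall hd hμ hdec hcon hcar htight (hdual _)
      fun x ρ hρ => ?_⟩
    have h1 : u ≤ g x - c * ρ := hgu (x, ρ) hρ
    have h2 : g x₀ - c * a ≤ u := by
      refine le_of_forall_pos_le_add fun ε hε => ?_
      have := hgx (a + ε / c) (by have := div_pos hε hc; linarith)
      have e : c * (a + ε / c) = c * a + ε := by field_simp
      linarith
    simp only [LinearMap.smul_apply, smul_eq_mul]
    have h3 : c⁻¹ * (g x₀ - c * a) ≤ c⁻¹ * (g x - c * ρ) :=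
      mul_le_mul_of_nonneg_left (h2.trans h1) (inv_pos.2 hc).le
    have e1 : c⁻¹ * (g x₀ - c * a) = c⁻¹ * g x₀ - a := by field_simp
    have e2 : c⁻¹ * (g x - c * ρ) = c⁻¹ * g x - ρ := by field_simp
    linarith

end Duality

/-! ### Projective limits -/

section ProjectiveLimit

variable {d : ℕ} {J : Type*} [Preorder J] {X : Type*} [AddCommGroup X] [Module ℝ X]
  [MeasurableSpace X] {Y : J → Type*} [∀ i, AddCommGroup (Y i)] [∀ i, Module ℝ (Y i)]
  [∀ i, MeasurableSpace (Y i)] {μ : BoxMeasures d X}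

/-- A linear form dominated by the pull-back of a seminorm factors through a dominated form. -/
theorem exists_factor_of_abs_le {V W : Type*} [AddCommGroup V] [Module ℝ V] [AddCommGroup W]
    [Module ℝ W] (f : V →ₗ[ℝ] W) (q : Seminorm ℝ W) {ℓ : V →ₗ[ℝ] ℝ} (h : ∀ x, |ℓ x| ≤ q (f x)) :
    ∃ ℓ' : W →ₗ[ℝ] ℝ, ℓ' ∘ₗ f = ℓ ∧ ∀ y, |ℓ' y| ≤ q y := by
  -- The domination makes `ℓ` vanish on the kernel of `f`, so it factors algebraically.
  have h1 : ℓ ∈ LinearMap.range f.dualMap := by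
    rw [LinearMap.range_dualMap_eq_dualAnnihilator_ker, Submodule.mem_dualAnnihilator]
    intro x hx
    have := h x
    rw [LinearMap.mem_ker.1 hx, map_zero] at this
    exact abs_nonpos_iff.1 this
  obtain ⟨φ, hφ⟩ := h1
  have hφ' : ∀ x, φ (f x) = ℓ x := fun x => LinearMap.congr_fun hφ x
  -- `φ` is dominated by `q` only on the range of `f`; it is restricted there and extended again by
  -- Hahn–Banach.
  obtain ⟨g, hg, hgq⟩ := exists_extension_of_le_sublinear
    ⟨LinearMap.range f, φ.domRestrict (LinearMap.range f)⟩ q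
    (fun c hc x => by rw [map_smul_eq_mul, Real.norm_of_nonneg hc.le]) (map_add_le_add q) (by
      rintro ⟨-, x, rfl⟩
      change φ (f x) ≤ q (f x)
      rw [hφ']
      exact (le_abs_self _).trans (h x))
  refine ⟨g, LinearMap.ext fun x => ?_, fun y => abs_le.2 ⟨?_, hgq y⟩⟩
  · rw [LinearMap.comp_apply, ← hφ' x]
    exact hg ⟨f x, x, rfl⟩
  · have := hgq (-y)
    rw [map_neg, map_neg_eq_map] at this
    linarith

theorem ProjectiveSystem.exists_factor [Nonempty J] [IsDirectedOrder J]
    (P : ProjectiveSystem X Y) {ℓ : X →ₗ[ℝ] ℝ} (hℓ : ℓ ∈ dualOf P.limitTopology) :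
    ∃ i, ∃ ℓ' ∈ dualOf (P.space i).topology, ℓ' ∘ₗ P.f i = ℓ := by
  obtain ⟨-, ⟨i, C, hC, rfl⟩, hb⟩ := P.isSeminormBase.mem_dualOf_iff.1 hℓ
  obtain ⟨q, rfl⟩ := (P.space i).isSeminormBase.ball C hC
  have h1 : ∀ x, |ℓ x| ≤ q.comp (P.f i) x := abs_le_seminorm fun y hy => hb y (by simpa using hy)
  obtain ⟨ℓ', hℓ', hq⟩ := exists_factor_of_abs_le (P.f i) q h1
  exact ⟨i, ℓ', (P.space i).mem_dualOf hC (M := 1) (by simpa using hq), hℓ'⟩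

theorem ProjectiveSystem.comp_mem_dualOf [Nonempty J] [IsDirectedOrder J]
    (P : ProjectiveSystem X Y) {i : J} {ℓ : Y i →ₗ[ℝ] ℝ}
    (hℓ : ℓ ∈ dualOf (P.space i).topology) : ℓ ∘ₗ P.f i ∈ dualOf P.limitTopology := by
  obtain ⟨C, hC, hb⟩ := (P.space i).isSeminormBase.mem_dualOf_iff.1 hℓ
  exact P.isSeminormBase.mem_dualOf_iff.2 ⟨_, ⟨i, C, hC, rfl⟩, fun y hy => hb _ hy⟩

theorem ProjectiveSystem.cramerSeq_vadd_preimage (P : ProjectiveSystem X Y)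
    (μ : BoxMeasures d X) {i : J} {C : Set (Y i)} (hC : C ∈ (P.space i).C₀) (x : X) (n : ℕ+) :
    cramerSeq μ n (x +ᵥ P.f i ⁻¹' C) = cramerSeq (μ.proj (P.f i)) n (P.f i x +ᵥ C) := by
  rw [vadd_preimage, cramerSeq_proj μ (P.f_measurable i), Measure.map_apply (P.f_measurable i)
    ((P.space i).stable.vadd _ _ ((P.space i).internal hC).2)]

/-- With `exists_entropy_lt`, this identifies the limit entropy as the infimum of the projected
ones: basic neighbourhoods come from a single index, with the same mass. -/
theorem ProjectiveSystem.entropy_le (P : ProjectiveSystem X Y) (μ : BoxMeasures d X) (i : J)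
    (x : X) : entropy d (cramerSeq μ) (translates P.limitFamily) x ≤
      entropy d (cramerSeq (μ.proj (P.f i))) (translates (P.space i).C₀) (P.f i x) := by
  refine le_iInf₂ ?_
  rintro - ⟨C, hC, rfl⟩
  refine (iInf₂_le _ ⟨_, ⟨i, C, hC, rfl⟩, rfl⟩).trans_eq ?_
  simp only [P.cramerSeq_vadd_preimage μ hC]

theorem ProjectiveSystem.exists_entropy_lt (P : ProjectiveSystem X Y) (μ : BoxMeasures d X)
    {x : X} {a : EReal} (h : entropy d (cramerSeq μ) (translates P.limitFamily) x < a) :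
    ∃ i, entropy d (cramerSeq (μ.proj (P.f i))) (translates (P.space i).C₀) (P.f i x) < a := by
  simp only [entropy, iInf_lt_iff] at h
  obtain ⟨-, ⟨-, ⟨i, C, hC, rfl⟩, rfl⟩, hlt⟩ := h
  simp only [P.cramerSeq_vadd_preimage μ hC] at hlt
  exact ⟨i, (iInf₂_le _ ⟨C, hC, rfl⟩).trans_lt hlt⟩

/-- The property concerns one neighbourhood at a time, hence one index; no decoupling on `X` itself
is needed. -/
theorem ProjectiveSystem.ruelleLanford (P : ProjectiveSystem X Y) (hd : 0 < d)
    (hμ : IsCompatibleInvariant μ) (hdec : ∀ i, LowerDecoupled (μ.proj (P.f i)))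
    (hcontrol : ∀ i, LocallyControlled (μ.proj (P.f i))) :
    RuelleLanford d (cramerSeq μ) (translates P.limitFamily) := by
  rintro x - ⟨-, ⟨i, C, hC, rfl⟩, rfl⟩
  have hC' := (P.space i).dilate (1 / 2) (by norm_num) C hC
  refine ⟨_, ⟨_, ⟨i, _, hC', rfl⟩, rfl⟩, ?_⟩
  simp only [P.cramerSeq_vadd_preimage μ hC, P.cramerSeq_vadd_preimage μ hC']
  exact limsup_cramerSeq_half_le hd (hμ.proj (P.f_measurable i)) (hdec i) (hcontrol i) hC _

theorem ProjectiveSystem.logLaplace_comp (P : ProjectiveSystem X Y) (μ : BoxMeasures d X)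
    {i : J} {ℓ : Y i →ₗ[ℝ] ℝ} (hℓ : Measurable ℓ) :
    logLaplace d (cramerSeq μ) (ℓ ∘ₗ P.f i) = logLaplace d (cramerSeq (μ.proj (P.f i))) ℓ := by
  funext n
  rw [logLaplace, logLaplace, cramerSeq_proj μ (P.f_measurable i),
    lintegral_map (by fun_prop) (P.f_measurable i)]
  rfl

theorem ProjectiveSystem.pressure_comp (P : ProjectiveSystem X Y) (μ : BoxMeasures d X)
    {i : J} {ℓ : Y i →ₗ[ℝ] ℝ} (hℓ : Measurable ℓ) :
    pressure d (cramerSeq μ) (ℓ ∘ₗ P.f i) = pressure d (cramerSeq (μ.proj (P.f i))) ℓ := by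
  rw [pressure, P.logLaplace_comp μ hℓ, pressure]

/-- By `hD`, the trace of a measurable set keeps its full mass, so the Ruelle–Lanford property
passes to `D` and the abstract principle applies there directly. -/
theorem RuelleLanford.weakLDP_trace {Z : Type*} [MeasurableSpace Z] {τ : TopologicalSpace Z}
    (hd : 0 < d) {ν : ℕ+ → Measure Z} {𝒱 : Z → Set (Set Z)} (h : RuelleLanford d ν 𝒱)
    (hnhds : ∀ x U, U ∈ 𝓝 x ↔ ∃ V ∈ 𝒱 x, V ⊆ U) (hmeas : ∀ x, ∀ V ∈ 𝒱 x, MeasurableSet V)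
    {D : Set Z} (hD : ∀ n K U, MeasurableSet K → MeasurableSet U → K ∩ D ⊆ U → ν n K ≤ ν n U) :
    WeakLDP d (TopologicalSpace.induced ((↑) : D → Z) τ) (fun n => traceMeasure (ν n) D)
      (entropy d (fun n => traceMeasure (ν n) D) (traceFamily D 𝒱)) := by
  refine RuelleLanford.weakLDP (τ := TopologicalSpace.induced ((↑) : D → Z) τ) hd ?_ ?_ ?_
  · rintro x - ⟨V, hV, rfl⟩
    obtain ⟨V', hV', hle⟩ := h x V hV
    refine ⟨_, ⟨V', hV', rfl⟩, ?_⟩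
    simp only [traceMeasure_preimage (hD _) (hmeas _ _ hV),
      traceMeasure_preimage (hD _) (hmeas _ _ hV')]
    exact hle
  · intro x U
    rw [nhds_induced, Filter.mem_comap]
    constructor
    · rintro ⟨T, hT, hTU⟩
      obtain ⟨V, hV, hVT⟩ := (hnhds _ _).1 hT
      exact ⟨_, ⟨V, hV, rfl⟩, (Set.preimage_mono hVT).trans hTU⟩
    · rintro ⟨-, ⟨V, hV, rfl⟩, hVU⟩
      exact ⟨V, (hnhds _ _).2 ⟨V, hV, subset_rfl⟩, hVU⟩
  · rintro x - ⟨V, hV, rfl⟩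
    exact measurable_subtype_coe (hmeas _ _ hV)

/-- The Fenchel–Young inequality on the projective limit. -/
theorem ProjectiveSystem.coe_add_le_pressure [Nonempty J] [IsDirectedOrder J]
    (P : ProjectiveSystem X Y) {ℓ : X →ₗ[ℝ] ℝ} (hℓ : ℓ ∈ dualOf P.limitTopology) {x : X} {ρ : ℝ}
    (hρ : (ρ : EReal) ≤ entropy d (cramerSeq μ) (translates P.limitFamily) x) :
    ((ℓ x + ρ : ℝ) : EReal) ≤ pressure d (cramerSeq μ) ℓ := by
  obtain ⟨i, ℓ', hℓ', rfl⟩ := P.exists_factor hℓ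
  rw [P.pressure_comp μ ((P.space i).dual_measurable ℓ' hℓ')]
  exact CramerField.coe_add_le_pressure hℓ' (hρ.trans (P.entropy_le μ i x))

end ProjectiveLimit

end CramerField

end

theorem mainTheorem2 {J : Type*} [Preorder J] [Nonempty J] [IsDirectedOrder J]
    {X : Type*} [AddCommGroup X] [Module ℝ X] [MeasurableSpace X]
    {Y : J → Type*} [∀ i, AddCommGroup (Y i)] [∀ i, Module ℝ (Y i)] [∀ i, MeasurableSpace (Y i)]
    (P : CramerField.ProjectiveSystem X Y) (d : ℕ) (hd : 0 < d)
    (D : Set X) (hD : Convex ℝ D)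
    (μ : CramerField.BoxMeasures d X) (hμ : CramerField.IsCompatibleInvariant μ)
    (hμD : CramerField.CarriedBy μ (CramerField.configsIn d D))
    (hdec : ∀ i, CramerField.LowerDecoupled (μ.proj (P.f i)))
    (hcontrol : ∀ i, CramerField.LocallyControlled (μ.proj (P.f i)))
    (ν : ℕ+ → Measure X) (hν : ν = CramerField.cramerSeq μ)
    (s : X → EReal)
    (hs : s = CramerField.entropy d ν (CramerField.translates P.limitFamily)) :
    (CramerField.WeakUpperBoundOn d P.limitTopology ν s D ∧
      CramerField.WeakLDP d P.limitTopology ν s ∧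
      CramerField.WeakLDP d (TopologicalSpace.induced ((↑) : D → X) P.limitTopology)
        (fun n => CramerField.traceMeasure (ν n) D)
        (CramerField.entropy d (fun n => CramerField.traceMeasure (ν n) D)
          (CramerField.traceFamily D (CramerField.translates P.limitFamily)))) ∧
    (∀ ℓ ∈ CramerField.dualOf P.limitTopology,
      Tendsto (CramerField.logLaplace d ν ℓ) atTop (𝓝 (CramerField.pressure d ν ℓ)) ∧
      ∀ x : X, CramerField.pressure d ν ℓ - s x ≥ ((ℓ x : ℝ) : EReal)) ∧
    ((∀ i, CramerField.LocallyConvexTight (P.space i).topology (μ.proj (P.f i)) (P.f i '' D)) →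
      ∀ x : X, s x = ⨅ ℓ ∈ CramerField.dualOf P.limitTopology,
        (CramerField.pressure d ν ℓ - ((ℓ x : ℝ) : EReal))) := by
  subst hν hs
  have hbase := P.isSeminormBase
  have hRL := P.ruelleLanford hd hμ hdec hcontrol
  have hnhds : ∀ x U, U ∈ @nhds X P.limitTopology x ↔
      ∃ V ∈ CramerField.translates P.limitFamily x, V ⊆ U := by
    intro x U
    rw [hbase.mem_nhds_iff]
    constructor
    · rintro ⟨C, hC, hCU⟩
      exact ⟨_, ⟨C, hC, rfl⟩, hCU⟩
    · rintro ⟨-, ⟨C, hC, rfl⟩, hCU⟩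
      exact ⟨C, hC, hCU⟩
  have hmeas : ∀ x, ∀ V ∈ CramerField.translates P.limitFamily x, MeasurableSet V := by
    rintro x - ⟨C, hC, rfl⟩
    exact P.measurableSet_vadd hC x
  have hcar : ∀ n K U, MeasurableSet K → MeasurableSet U → K ∩ D ⊆ U →
      CramerField.cramerSeq μ n K ≤ CramerField.cramerSeq μ n U :=
    fun n K U hK hU hKU => hμD.cramerSeq_le hD n hK hU hKU
  have hlim : ∀ ℓ ∈ CramerField.dualOf P.limitTopology,
      Tendsto (CramerField.logLaplace d (CramerField.cramerSeq μ) ℓ) atTop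
        (𝓝 (CramerField.pressure d (CramerField.cramerSeq μ) ℓ)) ∧
      CramerField.pressure d (CramerField.cramerSeq μ) ℓ ≠ ⊥ := by
    intro ℓ hℓ
    obtain ⟨i, ℓ', hℓ', rfl⟩ := P.exists_factor hℓ
    have hm := (P.space i).dual_measurable ℓ' hℓ'
    rw [P.pressure_comp μ hm, P.logLaplace_comp μ hm]
    exact ⟨CramerField.tendsto_logLaplace hd (hμ.proj (P.f_measurable i)) (hdec i) (hcontrol i) hℓ',
      CramerField.pressure_ne_bot (hμ.proj (P.f_measurable i)) (hcontrol i) hℓ'⟩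
  have hs0 := hμ.entropy_le_zero hbase.nonempty
  refine ⟨⟨hRL.weakUpperBoundOn (τ := P.limitTopology) hd
      (fun x V hV => (hnhds x V).2 ⟨V, hV, subset_rfl⟩) hmeas hcar,
    hRL.weakLDP (τ := P.limitTopology) hd hnhds hmeas,
    hRL.weakLDP_trace (τ := P.limitTopology) hd hnhds hmeas hcar⟩,
    fun ℓ hℓ => ⟨(hlim ℓ hℓ).1, fun x => ?_⟩, fun htight x => le_antisymm ?_ ?_⟩
  -- The entropy is at most 0, which excludes `⊤`; where it is `⊥`, the difference is `⊤` because
  -- the pressure is not `⊥`.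
  · have hfy := fun ρ : ℝ => P.coe_add_le_pressure (μ := μ) hℓ (x := x) (ρ := ρ)
    have hx0 := hs0 x
    generalize CramerField.entropy d (CramerField.cramerSeq μ)
      (CramerField.translates P.limitFamily) x = s at hfy hx0
    induction s with
    | bot => rw [EReal.sub_bot (hlim ℓ hℓ).2]; exact le_top
    | top => exact absurd hx0 (by simp)
    | coe ρ =>
      rw [ge_iff_le, EReal.le_sub_iff_add_le (by simp) (by simp), ← EReal.coe_add]
      exact hfy ρ le_rfl
  · refine le_iInf₂ fun ℓ hℓ => EReal.ge_of_forall_gt_iff_ge.1 fun ρ hρ => ?_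
    rw [EReal.le_sub_iff_add_le (by simp) (by simp), ← EReal.coe_add, add_comm]
    exact P.coe_add_le_pressure hℓ hρ.le
  · refine EReal.le_of_forall_lt_iff_le.1 fun a ha => ?_
    -- A strict bound on the entropy is already visible at one index; the form found on `Y i` is
    -- pulled back by `P.f i`, with the same pressure.
    obtain ⟨i, hi⟩ := P.exists_entropy_lt μ ha
    obtain ⟨ℓ, hℓ, hp⟩ := CramerField.exists_pressure_le hd (hμ.proj (P.f_measurable i)) (hdec i)
      (hcontrol i) (hμD.proj (P.f_measurable i)) (htight i) hi
    refine (iInf₂_le _ (P.comp_mem_dualOf hℓ)).trans ?_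
    rw [P.pressure_comp μ ((P.space i).dual_measurable ℓ hℓ),
      EReal.sub_le_iff_le_add (by simp) (by simp), LinearMap.comp_apply, ← EReal.coe_add, add_comm a]
    exact hp
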